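/- **Setting.** All functions are real valued, $\|\cdot\|$ and $(\cdot,\cdot)$ are the norm and the inner product of $L^2(\mathbb R)$, and $\|v\|_{H^1}^2=\|v\|^2+\|\partial_xv\|^2$. Let $T>0$ and let $a(\cdot,\cdot;t)$, $t\in[0,T]$, be symmetric bilinear forms on $H^1(\mathbb R)$, measurable in $t$, with $|a(v,w;t)|\le C_0\|v\|_{H^1}\|w\|_{H^1}$ and $c_0\|v\|_{H^1}^2\le a(v,v;t)$, where $c_0>0$. For $0\le s\le t\le T$ let $X(s,t)=\{w: w,\partial_rw\in L^2(s,t;H^1(\mathbb R))\}$ (continuous representatives), with $$\|w\|_{X(s,t)}^2=\int_s^t\big(\|w(r)\|_{H^1}^2+\|\partial_rw(r)\|_{H^1}^2\big)\,dr+\|w(s)\|^2 .$$ For $N\in\mathbb N$, $\beta>0$, $x_0\in\mathbb R$ let $P_{N,x_0}^\beta$ be the span of the generalized Hermite functions $(2^ii!)^{-1/2}H_i(\beta(x-x_0))e^{-\beta^2(x-x_0)^2/2}$, $0\le i\le N$, $H_i(x)=(-1)^ie^{x^2}\partial_x^ie^{-x^2}$, and let $\pi_{N,x_0}^\beta$ be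 the $L^2(\mathbb R)$-orthogonal projection onto it. For $w\in X(s,t)$, $v\in L^2(s,t;P_{N,x_0}^\beta)$, $\tilde v\in P_{N,x_0}^\beta$ put $$B_{s,t}(w,(v,\tilde v))=\int_s^t\big[(\partial_rw,v)+a(w,v;r)\big]dr+(w(s),\tilde v).$$ A continuity constant is a number $B_0$ such that $B_{s,t}(w,(v,\tilde v))\le B_0\|w\|_{X(s,t)}\big(\int_s^t\|v\|_{H^1}^2dr+\|\tilde v\|^2\big)^{1/2}$ for all such $s,t,N,\beta,x_0,w,v,\tilde v$. Put $$b_{N,\beta}=\min\Big\{\tfrac14,\ \tfrac{c_0}4,\ \tfrac{c_0}{2(2N\beta^2+1)^2(C_0+1)^2}\Big\}.$$ Let $f\in L^2(0,T;L^2(\mathbb R))$, $u_0\in L^2(\mathbb R)$, and let $u\in X(0,T)$ solve $(\partial_tu,v)+a(u,v;t)=(f,v)$ for all $v\in H^1(\mathbb R)$ and almost every $t\in[0,T]$, with $(u(0),\tilde v)=(u_0,\tilde v)$ for all $\tilde v\in H^1(\mathbb R)$. **Adaptive method.** Let $0=t_0\le t_1\le\dots\le t_{K+1}=T$, with parameters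 $(N_i,\beta_i,x_{0,i})$ on $[t_i,t_{i+1}]$, $0\le i\le K$; write $P_i,\pi_i$ for the corresponding space and projection. At each $t_{i+1}$, $0\le i<K$, exactly one of the three parameters may be changed: the scaling factor (scaling, to $\tilde\beta_i=\beta_{i+1}>0$), the displacement (moving, to $\tilde x_{0,i}=x_{0,i+1}$) or the expansion order (to $\tilde N_i=N_{i+1}$; coarsening if $\tilde N_i<N_i$). The numerical solution on $[t_i,t_{i+1}]$ is $U_i\in X(t_i,t_{i+1})$ with values in $P_i$ such that $$B_{t_i,t_{i+1}}(U_i,(v,\tilde v))=\int_{t_i}^{t_{i+1}}(f,v)\,dr+(g_i,\tilde v)\qquad\text{for all }v\in L^2(t_i,t_{i+1};P_i),\ \tilde v\in P_i,$$ where $g_0=u(0)$ and $g_{i+1}=\pi_{i+1}U_i(t_{i+1})$. Write $U_i^*=U_i(t_{i+1})$ for the numerical solution right before the $(i+1)$-st adaptation. **Theorem.** Continuity constants $B_0$ exist, and for every continuity constant $B_0$ (a constant that depends only on the forms $a(\cdot,\cdot;t)$, $t\in[0,T]$), for all data and every run of the adaptive method as above, the error $e(T)=\|u(T)-U_K(T)\|$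 satisfies $$e(T)\le e_0+e_{\rm S}+e_{\rm M}+e_{\rm C},\qquad e_0=\sum_{i=0}^{K}\frac{b_{N_i,\beta_i}+B_0}{b_{N_i,\beta_i}}\,\|(I-\pi_i)u\|_{X(t_i,t_{i+1})},$$ where the $i$-th norm in $e_0$ is replaced by $0$ if $i\ge1$ and $t_i=t_{i+1}$, and $$e_{\rm S}=\sum_{\text{scaling steps}}\frac{|\tilde\beta_i-\beta_i|\sqrt{1+\tilde\beta_i/\beta_i}}{\sqrt2\,\tilde\beta_i}\,\|(x-x_{0,i})\,\partial_xU_i^*\|,\qquad e_{\rm M}=\sum_{\text{moving steps}}|x_{0,i}-\tilde x_{0,i}|\,\|\partial_xU_i^*\|,$$ $$e_{\rm C}=\sum_{\text{coarsening steps}}\|(I-\pi_{\tilde N_i,x_{0,i}}^{\beta_i})U_i^*\| .$$ Moreover $$e_{\rm S}\le\sum_{\text{scaling steps}}\frac{|\tilde\beta_i-\beta_i|\sqrt{1+\tilde\beta_i/\beta_i}}{\sqrt2\,\tilde\beta_i}\,(2N_i+1)\|U_i^*\|,\qquad e_{\rm M}\le\sum_{\text{moving steps}}\sqrt{2N_i+1}\,\beta_i\,|x_{0,i}-\tilde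 x_{0,i}|\,\|U_i^*\| .$$ -/

import Mathlib

open MeasureTheory Set
open scoped ContDiff

noncomputable section

namespace AdaptiveHermite

/-! ### The spaces `L²(ℝ)` and `H¹(ℝ)` -/

/-- The real Hilbert space `L²(ℝ)`. -/
abbrev L2 : Type := Lp ℝ 2 (volume : Measure ℝ)

/-- `g'` is the weak derivative of `g`. -/
def IsWeakDeriv (g g' : ℝ → ℝ) : Prop :=
  ∀ φ : ℝ → ℝ, ContDiff ℝ ∞ φ → HasCompactSupport φ →
    ∫ x, g x * deriv φ x = -∫ x, g' x * φ x

lemma memLp_of_test {φ : ℝ → ℝ} (hφ : Continuous φ) (hc : HasCompactSupport φ) :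
    MemLp φ 2 (volume : Measure ℝ) := hφ.memLp_of_hasCompactSupport hc

lemma integral_mul_eq_inner {φ : ℝ → ℝ} (h : MemLp φ 2 (volume : Measure ℝ)) (g : L2) :
    ∫ x, g x * φ x = inner ℝ (h.toLp φ) g := by
  rw [L2.inner_def]
  refine integral_congr_ae ?_
  filter_upwards [h.coeFn_toLp] with x hx
  simp [hx]

lemma isWeakDeriv_iff (g g' : L2) :
    IsWeakDeriv g g' ↔ ∀ (φ : ℝ → ℝ) (hφ : ContDiff ℝ ∞ φ) (hc : HasCompactSupport φ),
      inner ℝ ((memLp_of_test (hφ.continuous_deriv (by simp)) hc.deriv).toLp _) g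
        + inner ℝ ((memLp_of_test hφ.continuous hc).toLp _) g' = (0 : ℝ) := by
  unfold IsWeakDeriv
  refine forall_congr' fun φ => forall_congr' fun hφ => forall_congr' fun hc => ?_
  rw [← integral_mul_eq_inner, ← integral_mul_eq_inner, eq_neg_iff_add_eq_zero]

/-- The Sobolev space `H¹(ℝ)`: pairs `(g, g')` in `L²(ℝ) × L²(ℝ)` such that `g'` is the weak
derivative of `g`, with the norm `‖g‖_{H¹}² = ‖g‖² + ‖g'‖²`.  (The second component is determined
by the first one.) -/
def H1 : Submodule ℝ (WithLp 2 (L2 × L2)) where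
  carrier := {g | IsWeakDeriv g.fst g.snd}
  zero_mem' := by
    simp only [mem_ofPred_eq, isWeakDeriv_iff]
    intro φ hφ hc
    simp
  add_mem' := by
    intro a b ha hb
    simp only [mem_ofPred_eq, isWeakDeriv_iff] at *
    intro φ hφ hc
    simp only [WithLp.add_fst, WithLp.add_snd, inner_add_right]
    linarith [ha φ hφ hc, hb φ hφ hc]
  smul_mem' := by
    intro c a ha
    simp only [mem_ofPred_eq, isWeakDeriv_iff] at *
    intro φ hφ hc
    simp only [WithLp.smul_fst, WithLp.smul_snd, inner_smul_right]
    rw [← mul_add, ha φ hφ hc, mul_zero]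

lemma isClosed_H1 : IsClosed (H1 : Set (WithLp 2 (L2 × L2))) := by
  have : (H1 : Set (WithLp 2 (L2 × L2))) =
      ⋂ (φ : ℝ → ℝ) (hφ : ContDiff ℝ ∞ φ) (hc : HasCompactSupport φ),
      {g | inner ℝ ((memLp_of_test (hφ.continuous_deriv (by simp)) hc.deriv).toLp _) g.fst
        + inner ℝ ((memLp_of_test hφ.continuous hc).toLp _) g.snd = (0 : ℝ)} := by
    ext g
    simp only [mem_iInter, mem_ofPred_eq, ← isWeakDeriv_iff]
    rfl
  rw [this]
  refine isClosed_iInter fun φ => isClosed_iInter fun hφ => isClosed_iInter fun hc =>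
    isClosed_eq ?_ continuous_const
  have h1 : Continuous fun g : WithLp 2 (L2 × L2) => g.fst := by fun_prop
  have h2 : Continuous fun g : WithLp 2 (L2 × L2) => g.snd := by fun_prop
  exact (continuous_const.inner h1).add (continuous_const.inner h2)

instance : CompleteSpace H1 := isClosed_H1.completeSpace_coe

/-- The inclusion `H¹(ℝ) → L²(ℝ)`. -/
def toL2 : H1 →ₗ[ℝ] L2 where
  toFun g := g.1.fst
  map_add' _ _ := rfl
  map_smul' _ _ := rfl

/-- The spatial (weak) derivative `∂ₓ : H¹(ℝ) → L²(ℝ)`. -/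
def dx : H1 →ₗ[ℝ] L2 where
  toFun g := g.1.snd
  map_add' _ _ := rfl
  map_smul' _ _ := rfl

/-- The embedding `H¹(ℝ) → L²(ℝ)` is injective: weak derivatives are unique. -/
lemma toL2_injective : Function.Injective toL2 := by
  rw [← LinearMap.ker_eq_bot, LinearMap.ker_eq_bot']
  intro g hg
  have h0 : g.1.fst = 0 := hg
  have hw : IsWeakDeriv g.1.fst g.1.snd := g.2
  have hs : g.1.snd = 0 := by
    rw [Lp.eq_zero_iff_ae_eq_zero]
    refine ae_eq_zero_of_integral_contDiff_smul_eq_zero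
      ((Lp.memLp g.1.snd).locallyIntegrable (by norm_num)) ?_
    intro φ hφ hc
    have h := (isWeakDeriv_iff _ _).1 hw φ hφ hc
    rw [h0, inner_zero_right, zero_add, ← integral_mul_eq_inner] at h
    simpa [mul_comm] using h
  apply Subtype.ext
  apply (WithLp.equiv 2 (L2 × L2)).injective
  exact Prod.ext h0 hs

/-! ### Generalized Hermite functions -/

/-- The (physicists') Hermite polynomial `H_i(x) = (-1)^i e^{x²} ∂_x^i e^{-x²}`. -/
def hermiteH (i : ℕ) (x : ℝ) : ℝ :=
  (-1) ^ i * Real.exp (x ^ 2) * iteratedDeriv i (fun y : ℝ => Real.exp (-y ^ 2)) x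

/-- Discretization parameters: expansion order `N`, scaling factor `β > 0`, displacement `x₀`. -/
structure Params where
  N : ℕ
  β : ℝ
  x₀ : ℝ
  β_pos : 0 < β

/-- The generalized Hermite function
`(2^i i!)^{-1/2} H_i(β(x-x₀)) e^{-(β(x-x₀))²/2}`. -/
def hermiteFun (p : Params) (i : ℕ) (x : ℝ) : ℝ :=
  1 / √(2 ^ i * (i.factorial : ℝ)) * hermiteH i (p.β * (x - p.x₀))
    * Real.exp (-(p.β * (x - p.x₀)) ^ 2 / 2)

/-- A polynomial times a Gaussian. -/
def polyGauss (p : Params) (Q : Polynomial ℝ) (x : ℝ) : ℝ :=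
  Q.eval (p.β * (x - p.x₀)) * Real.exp (-(p.β * (x - p.x₀)) ^ 2 / 2)

lemma exists_poly_iteratedDeriv (i : ℕ) : ∃ Q : Polynomial ℝ,
    iteratedDeriv i (fun y : ℝ => Real.exp (-y ^ 2)) = fun x => Q.eval x * Real.exp (-x ^ 2) := by
  induction i with
  | zero => exact ⟨1, by simp⟩
  | succ n ih =>
    obtain ⟨Q, hQ⟩ := ih
    refine ⟨Polynomial.derivative Q - 2 * Polynomial.X * Q, ?_⟩
    rw [iteratedDeriv_succ, hQ]
    funext x
    have h1 : HasDerivAt (fun y : ℝ => Real.exp (-y ^ 2)) (Real.exp (-x ^ 2) * -(2 * x)) x := by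
      have := ((hasDerivAt_pow 2 x).fun_neg).exp
      simpa using this
    have h2 : HasDerivAt (fun x => Q.eval x * Real.exp (-x ^ 2)) _ x := (Q.hasDerivAt x).mul h1
    rw [h2.deriv]
    simp
    ring

lemma hermiteFun_eq (p : Params) (i : ℕ) : ∃ Q : Polynomial ℝ, hermiteFun p i = polyGauss p Q := by
  obtain ⟨Q, hQ⟩ := exists_poly_iteratedDeriv i
  refine ⟨Polynomial.C (1 / √(2 ^ i * (i.factorial : ℝ)) * (-1) ^ i) * Q, ?_⟩
  funext x
  simp only [hermiteFun, hermiteH, hQ, polyGauss, Polynomial.eval_mul, Polynomial.eval_C]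
  have : Real.exp ((p.β * (x - p.x₀)) ^ 2) * Real.exp (-(p.β * (x - p.x₀)) ^ 2) = 1 := by
    rw [← Real.exp_add]; simp
  linear_combination (1 / √(2 ^ i * (i.factorial : ℝ)) * (-1) ^ i
    * Q.eval (p.β * (x - p.x₀)) * Real.exp (-(p.β * (x - p.x₀)) ^ 2 / 2)) * this

lemma integrable_poly_gauss (Q : Polynomial ℝ) :
    Integrable fun x : ℝ => Q.eval x * Real.exp (-x ^ 2) := by
  induction Q using Polynomial.induction_on' with
  | add p q hp hq =>
    refine (hp.add hq).congr (Filter.Eventually.of_forall fun x => ?_)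
    simp [add_mul]
  | monomial n a =>
    have h := (integrable_rpow_mul_exp_neg_mul_sq (b := 1) one_pos (s := (n : ℝ))
      (by linarith [(n.cast_nonneg : (0 : ℝ) ≤ n)])).const_mul a
    refine h.congr (Filter.Eventually.of_forall fun x => ?_)
    simp [Real.rpow_natCast, mul_assoc]

lemma polyGauss_memLp (p : Params) (Q : Polynomial ℝ) :
    MemLp (polyGauss p Q) 2 (volume : Measure ℝ) := by
  have hc : Continuous (polyGauss p Q) := by
    unfold polyGauss
    have := Q.continuous
    fun_prop
  rw [memLp_two_iff_integrable_sq hc.aestronglyMeasurable]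
  have h := ((integrable_poly_gauss (Q ^ 2)).comp_mul_left' p.β_pos.ne').comp_sub_right p.x₀
  refine h.congr (Filter.Eventually.of_forall fun x => ?_)
  simp only [polyGauss, Polynomial.eval_pow, mul_pow, ← Real.exp_nat_mul]
  congr 2
  push_cast
  ring

lemma polyGauss_hasDerivAt (p : Params) (Q : Polynomial ℝ) (x : ℝ) :
    HasDerivAt (polyGauss p Q)
      (polyGauss p (Polynomial.C p.β * (Polynomial.derivative Q - Polynomial.X * Q)) x) x := by
  have hy : HasDerivAt (fun x => p.β * (x - p.x₀)) p.β x := by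
    simpa using ((hasDerivAt_id x).sub_const p.x₀).const_mul p.β
  have h1 : HasDerivAt (fun x => Q.eval (p.β * (x - p.x₀)))
      ((Polynomial.derivative Q).eval (p.β * (x - p.x₀)) * p.β) x :=
    HasDerivAt.comp (h := fun x => p.β * (x - p.x₀)) x (Q.hasDerivAt (p.β * (x - p.x₀))) hy
  have h2 : HasDerivAt (fun x => Real.exp (-(p.β * (x - p.x₀)) ^ 2 / 2))
      (Real.exp (-(p.β * (x - p.x₀)) ^ 2 / 2) * (-(2 * (p.β * (x - p.x₀)) * p.β) / 2)) x := by
    have := (((hy.fun_pow 2).fun_neg).div_const 2).exp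
    simpa using this
  refine (h1.mul h2).congr_deriv ?_
  simp [polyGauss]
  ring

lemma hermiteFun_memLp (p : Params) (i : ℕ) :
    MemLp (hermiteFun p i) 2 (volume : Measure ℝ) := by
  obtain ⟨Q, hQ⟩ := hermiteFun_eq p i
  rw [hQ]; exact polyGauss_memLp p Q

lemma deriv_hermiteFun_memLp (p : Params) (i : ℕ) :
    MemLp (deriv (hermiteFun p i)) 2 (volume : Measure ℝ) := by
  obtain ⟨Q, hQ⟩ := hermiteFun_eq p i
  rw [hQ, show deriv (polyGauss p Q) = _ from funext fun x => (polyGauss_hasDerivAt p Q x).deriv]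
  exact polyGauss_memLp p _

lemma hermiteFun_isWeakDeriv (p : Params) (i : ℕ) :
    IsWeakDeriv (hermiteFun p i) (deriv (hermiteFun p i)) := by
  intro φ hφ hc
  have hd : Differentiable ℝ φ := hφ.differentiable (by simp)
  have h1 := memLp_of_test hφ.continuous hc
  have h2 := memLp_of_test (hφ.continuous_deriv (by simp)) hc.deriv
  refine integral_mul_deriv_eq_deriv_mul_of_integrable (fun x _ => ?_)
    (fun x _ => (hd x).hasDerivAt) ((hermiteFun_memLp p i).integrable_mul h2)
    ((deriv_hermiteFun_memLp p i).integrable_mul h1) ((hermiteFun_memLp p i).integrable_mul h1)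
  obtain ⟨Q, hQ⟩ := hermiteFun_eq p i
  rw [hQ]
  exact (polyGauss_hasDerivAt p Q x).differentiableAt.hasDerivAt

/-- The generalized Hermite function as an element of `H¹(ℝ)`. -/
def hermiteH1 (p : Params) (i : ℕ) : H1 :=
  ⟨WithLp.toLp 2 ((hermiteFun_memLp p i).toLp _, (deriv_hermiteFun_memLp p i).toLp _), by
    intro φ hφ hc
    have h := hermiteFun_isWeakDeriv p i φ hφ hc
    rw [integral_congr_ae (g := fun x => hermiteFun p i x * deriv φ x),
      integral_congr_ae (f := fun x => _ * φ x) (g := fun x => deriv (hermiteFun p i) x * φ x)]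
    · exact h
    · filter_upwards [(deriv_hermiteFun_memLp p i).coeFn_toLp] with x hx
      simp [hx]
    · filter_upwards [(hermiteFun_memLp p i).coeFn_toLp] with x hx
      simp [hx]⟩

/-- The space spanned by the generalized Hermite functions of order `0, …, N`, inside `H¹(ℝ)`. -/
def P (p : Params) : Submodule ℝ H1 :=
  Submodule.span ℝ (range fun i : Fin (p.N + 1) => hermiteH1 p i)

instance (p : Params) : FiniteDimensional ℝ (P p) :=
  FiniteDimensional.span_of_finite ℝ (finite_range _)

/-- The same space inside `L²(ℝ)`. -/
def PL2 (p : Params) : Submodule ℝ L2 := (P p).map toL2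

instance (p : Params) : FiniteDimensional ℝ (PL2 p) := by
  unfold PL2; infer_instance

/-- The `L²(ℝ)`-orthogonal projection onto the Hermite space; its values lie in `H¹(ℝ)`. -/
def proj (p : Params) : L2 →ₗ[ℝ] H1 :=
  (P p).subtype ∘ₗ ((P p).equivMapOfInjective toL2 toL2_injective).symm.toLinearMap ∘ₗ
    ((PL2 p).orthogonalProjectionOnto).toLinearMap

/-- As an element of `L²(ℝ)`, `proj p g` is the orthogonal projection of `g`. -/
lemma toL2_proj (p : Params) (g : L2) : toL2 (proj p g) = (PL2 p).starProjection g := by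
  have h := congrArg Subtype.val (((P p).equivMapOfInjective toL2 toL2_injective).apply_symm_apply
    ((PL2 p).orthogonalProjectionOnto g))
  rw [Submodule.coe_equivMapOfInjective_apply] at h
  exact h

/-! ### Bochner spaces in time -/

/-- `u ∈ X(s,t)`, i.e. `u ∈ L²(s,t; H¹)` and `∂ₛu ∈ L²(s,t; H¹)`.  The function `u` is the
absolutely continuous representative, so that its values at single times make sense; the time
derivative `∂ₛu = deriv u` then exists almost everywhere on `(s,t)`. -/
structure MemX (s t : ℝ) (u : ℝ → H1) : Prop where
  memLp : MemLp u 2 (volume.restrict (Icc s t))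
  memLp_deriv : MemLp (deriv u) 2 (volume.restrict (Icc s t))
  eq_add_integral : ∀ r ∈ Icc s t, u r = u s + ∫ τ in s..r, deriv u τ

/-- `‖u‖_{X(s,t)} = (∫ₛᵗ (‖u‖_{H¹}² + ‖∂ₛu‖_{H¹}²) dr + ‖u(s)‖²)^{1/2}`. -/
def normX (s t : ℝ) (u : ℝ → H1) : ℝ :=
  √((∫ r in s..t, (‖u r‖ ^ 2 + ‖deriv u r‖ ^ 2)) + ‖toL2 (u s)‖ ^ 2)

/-- `v ∈ L²(s,t; P)`, `P` the Hermite space with parameters `p`. -/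
def MemL2P (p : Params) (s t : ℝ) (v : ℝ → H1) : Prop :=
  MemLp v 2 (volume.restrict (Icc s t)) ∧ ∀ r, v r ∈ P p

/-- `‖(v,ṽ)‖_Y = (∫ₛᵗ ‖v‖_{H¹}² dr + ‖ṽ‖²)^{1/2}`. -/
def normY (s t : ℝ) (v : ℝ → H1) (v' : H1) : ℝ :=
  √((∫ r in s..t, ‖v r‖ ^ 2) + ‖toL2 v'‖ ^ 2)

/-! ### The parabolic problem -/

/-- `a(·,·;t)`, `t ∈ [0,T]`, is a (measurable) family of symmetric bilinear forms on `H¹(ℝ)`,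
bounded with constant `C₀` and coercive with constant `c₀ > 0`. -/
structure IsParabolicForm (T c₀ C₀ : ℝ) (a : ℝ → H1 →ₗ[ℝ] H1 →ₗ[ℝ] ℝ) : Prop where
  c₀_pos : 0 < c₀
  aestronglyMeasurable : ∀ v w,
    AEStronglyMeasurable (fun t => a t v w) (volume.restrict (Icc 0 T))
  symm : ∀ t ∈ Icc 0 T, ∀ v w, a t v w = a t w v
  bounded : ∀ t ∈ Icc 0 T, ∀ v w, |a t v w| ≤ C₀ * ‖v‖ * ‖w‖
  coercive : ∀ t ∈ Icc 0 T, ∀ v, c₀ * ‖v‖ ^ 2 ≤ a t v v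

/-- `u ∈ X(0,T)` is the solution of `(∂ₜu, v) + a(u, v; t) = (f, v)` for all `v ∈ H¹(ℝ)` and
(almost) all `t ∈ [0,T]`, with the initial condition `(u(0), ṽ) = (u₀, ṽ)` for all `ṽ`. -/
structure IsSolution (T : ℝ) (a : ℝ → H1 →ₗ[ℝ] H1 →ₗ[ℝ] ℝ) (f : ℝ → L2) (u₀ : L2)
    (u : ℝ → H1) : Prop where
  memX : MemX 0 T u
  weak_eq : ∀ v : H1, ∀ᵐ t ∂(volume.restrict (Icc 0 T)),
    inner ℝ (toL2 (deriv u t)) (toL2 v) + a t (u t) v = inner ℝ (f t) (toL2 v)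
  initial : ∀ v : H1, inner ℝ (toL2 (u 0)) (toL2 v) = (inner ℝ u₀ (toL2 v) : ℝ)

/-- `B(u,(v,ṽ)) = ∫ₛᵗ [(∂ᵣu, v) + a(u, v; r)] dr + (u(s), ṽ)`. -/
def B (a : ℝ → H1 →ₗ[ℝ] H1 →ₗ[ℝ] ℝ) (s t : ℝ) (u v : ℝ → H1) (v' : H1) : ℝ :=
  (∫ r in s..t, (inner ℝ (toL2 (deriv u r)) (toL2 (v r)) + a r (u r) (v r)))
    + inner ℝ (toL2 (u s)) (toL2 v')

/-- `B₀` is a continuity constant of the operator `B`, on every `X(s,t) × Y` with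
`0 ≤ s ≤ t ≤ T` and for all discretization parameters. -/
def IsContinuityConst (T : ℝ) (a : ℝ → H1 →ₗ[ℝ] H1 →ₗ[ℝ] ℝ) (B₀ : ℝ) : Prop :=
  ∀ s t, 0 ≤ s → s ≤ t → t ≤ T → ∀ (p : Params) (u v : ℝ → H1) (v' : H1),
    MemX s t u → MemL2P p s t v → v' ∈ P p →
      B a s t u v v' ≤ B₀ * normX s t u * normY s t v v'

/-- The Galerkin scheme on `[s,t]` with parameters `p` and datum `g` at time `s`: `U` takes values
in the Hermite space and `B(U,(v,ṽ)) = ∫ₛᵗ (f, v) dr + (g, ṽ)` for all test functions. -/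
structure IsGalerkin (a : ℝ → H1 →ₗ[ℝ] H1 →ₗ[ℝ] ℝ) (f : ℝ → L2) (p : Params) (s t : ℝ)
    (g : H1) (U : ℝ → H1) : Prop where
  mem : ∀ r ∈ Icc s t, U r ∈ P p
  memX : MemX s t U
  eq : ∀ (v : ℝ → H1) (v' : H1), MemL2P p s t v → v' ∈ P p →
    B a s t U v v' = (∫ r in s..t, inner ℝ (f r) (toL2 (v r))) + inner ℝ (toL2 g) (toL2 v')

/-- `b_{N,β} = min {1/4, c₀/4, c₀ / (2 (2Nβ²+1)² (C₀+1)²)}`. -/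
def bConst (c₀ C₀ : ℝ) (p : Params) : ℝ :=
  min (1 / 4) (min (c₀ / 4) (c₀ / (2 * (2 * p.N * p.β ^ 2 + 1) ^ 2 * (C₀ + 1) ^ 2)))

/-! ### Adaptive steps -/

/-- One adaptive step: changing the scaling factor, the displacement, or the expansion order
(coarsening or refinement). -/
inductive Step where
  | scale (β' : ℝ) (h : 0 < β')
  | move (x₀' : ℝ)
  | order (N' : ℕ)

/-- The parameters after an adaptive step. -/
def Step.apply (p : Params) : Step → Params
  | .scale β' h => ⟨p.N, β', p.x₀, h⟩
  | .move x₀' => ⟨p.N, p.β, x₀', p.β_pos⟩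
  | .order N' => ⟨N', p.β, p.x₀, p.β_pos⟩

/-- The factor `|β̃ - β| (1 + β̃/β)^{1/2} / (√2 β̃)` of a scaling step from `β` to `β̃`. -/
def scaleFactor (β β' : ℝ) : ℝ := |β' - β| * √(1 + β' / β) / (√2 * β')

/-- The norm `‖(x - x₀) ∂ₓU‖` in `L²(ℝ)`; it is finite for `U` in a Hermite space. -/
def normXDx (x₀ : ℝ) (U : H1) : ℝ :=
  (eLpNorm (fun x => (x - x₀) * dx U x) 2 volume).toReal

/-- Contribution of a step to `e_S`; `p`, `U` are the parameters and the numerical solution right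
before the step. -/
def Step.eS (p : Params) (U : H1) : Step → ℝ
  | .scale β' _ => scaleFactor p.β β' * normXDx p.x₀ U
  | _ => 0

/-- Contribution of a step to the further bound of `e_S`. -/
def Step.eS' (p : Params) (U : H1) : Step → ℝ
  | .scale β' _ => scaleFactor p.β β' * (2 * p.N + 1) * ‖toL2 U‖
  | _ => 0

/-- Contribution of a step to `e_M`. -/
def Step.eM (p : Params) (U : H1) : Step → ℝ
  | .move x₀' => |p.x₀ - x₀'| * ‖dx U‖
  | _ => 0

/-- Contribution of a step to the further bound of `e_M`. -/
def Step.eM' (p : Params) (U : H1) : Step → ℝ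
  | .move x₀' => √(2 * p.N + 1) * p.β * |p.x₀ - x₀'| * ‖toL2 U‖
  | _ => 0

/-- Contribution of a step to `e_C`: only coarsening steps contribute. -/
def Step.eC (p : Params) (U : H1) : Step → ℝ
  | .order N' =>
    if N' < p.N then ‖toL2 U - toL2 (proj ((Step.order N').apply p) (toL2 U))‖ else 0
  | _ => 0

/-- A run of the adaptive Galerkin method for the solution `u` with `K` adaptive steps at the times
`τ 1 ≤ … ≤ τ K` in `[0,T] = [τ 0, τ (K+1)]`.  The parameters `p i` and the numerical solution `U i`
are those used on `[τ i, τ (i+1)]`; at time `τ (i+1)` the step `σ i` is carried out, and the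
numerical solution is replaced by its `L²`-projection onto the new Hermite space. -/
structure IsRun (T : ℝ) (a : ℝ → H1 →ₗ[ℝ] H1 →ₗ[ℝ] ℝ) (f : ℝ → L2) (u : ℝ → H1) (K : ℕ)
    (τ : ℕ → ℝ) (p : ℕ → Params) (σ : ℕ → Step) (U : ℕ → ℝ → H1) : Prop where
  start : τ 0 = 0
  finish : τ (K + 1) = T
  mono : ∀ i ≤ K, τ i ≤ τ (i + 1)
  params : ∀ i < K, p (i + 1) = (σ i).apply (p i)
  galerkin_zero : IsGalerkin a f (p 0) (τ 0) (τ 1) (u 0) (U 0)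
  galerkin_succ : ∀ i < K, IsGalerkin a f (p (i + 1)) (τ (i + 1)) (τ (i + 2))
    (proj (p (i + 1)) (toL2 (U i (τ (i + 1))))) (U (i + 1))

/-- The projection error `‖(I - π)u‖_{X(τᵢ,τᵢ₊₁)}`, set to `0` if `i ≥ 1` and `τᵢ = τᵢ₊₁`. -/
def projErr (u : ℝ → H1) (τ : ℕ → ℝ) (p : ℕ → Params) (i : ℕ) : ℝ :=
  open Classical in
  if 1 ≤ i ∧ τ i = τ (i + 1) then 0
  else normX (τ i) (τ (i + 1)) fun r => u r - proj (p i) (toL2 (u r))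

/-- The discretization error `e₀`. -/
def e₀ (c₀ C₀ B₀ : ℝ) (u : ℝ → H1) (K : ℕ) (τ : ℕ → ℝ) (p : ℕ → Params) : ℝ :=
  ∑ i ∈ Finset.range (K + 1),
    (bConst c₀ C₀ (p i) + B₀) / bConst c₀ C₀ (p i) * projErr u τ p i

end AdaptiveHermite

end

open AdaptiveHermite

/-!
The argument compares the Galerkin solution `U` on an interval `[s, t]` with the projection `π u` of
the exact solution.  Put `θ = U - π u` and `η = u - π u`.  Both `u` and `U` satisfy the equation for
test functions in the Hermite space, so `B(θ, (v, 0)) = B(η, (v, 0))` for such `v`.  With `v = θ`,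
the energy identity `2 ∫ (∂ᵣθ, θ) = ‖θ(t)‖² - ‖θ(s)‖²` (`MemX.norm_sq_sub`), coercivity and the
definition of a continuity constant give `‖θ(t)‖² ≤ ‖θ(s)‖² + (2 c₀)⁻¹ B₀² ‖η‖_X²`
(`norm_galerkin_sub_proj_le`).  Since `b² ≤ 2 c₀` and `‖η(t)‖ ≤ ‖η‖_X`, the error at time `t` is at
most `‖θ(s)‖ + (b + B₀) / b ‖η‖_X` (`norm_sub_galerkin_le`).

At the initial time `θ` vanishes.  At an adaptation time `θ(s)` is the projection of the error right
before the adaptation, so on intervals of positive length the error is carried over without any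
loss.  On an interval of length zero, where no projection error of `u` is counted, the solution is
only projected to the new Hermite space, and the defect `‖U* - π U*‖` has to be paid
(`IsRun.norm_sub_succ_le`).

This defect is bounded in `norm_sub_proj_step_le`.  The Hermite space consists of the functions
`Q(β(x - x₀)) e^{-β²(x-x₀)²/2}` with `Q` in the span of the first Hermite polynomials, a space of
polynomials that depends on `N` only (`P_eq_map`).  Keeping `Q` and changing `β` or `x₀` gives a
competitor for the best approximation, and its distance is estimated by integrating the derivative
with respect to the parameter (`lintegral_sub_sq_le`).

The inverse inequalities for `∂ₓ` and `(x - x₀) ∂ₓ` reduce to identities for the functional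
`Q ↦ ∫ Q e^{-y²}`, obtained from integration by parts, together with the spectral bounds
for the operator `Q ↦ 2 y Q' - Q''`, whose eigenvectors are the Hermite polynomials
(`gaussI_gaussDeriv_sq_le`, `gaussI_X_gaussDeriv_sq_le`).
-/

noncomputable section

namespace AdaptiveHermite

section Hermite

open Polynomial

/-! ### The Gaussian functional on polynomials -/

/-- Integration of a polynomial against the Gaussian weight `e^{-y²}`. -/
def gaussI : ℝ[X] →ₗ[ℝ] ℝ where
  toFun Q := ∫ y : ℝ, Q.eval y * Real.exp (-y ^ 2)
  map_add' Q R := by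
    rw [← integral_add (integrable_poly_gauss Q) (integrable_poly_gauss R)]
    simp [add_mul]
  map_smul' c Q := by
    simp [← integral_const_mul, mul_assoc]

lemma gaussI_apply (Q : ℝ[X]) : gaussI Q = ∫ y : ℝ, Q.eval y * Real.exp (-y ^ 2) := rfl

lemma gaussI_sq_nonneg (Q : ℝ[X]) : 0 ≤ gaussI (Q ^ 2) := by
  rw [gaussI_apply]
  refine integral_nonneg fun y => ?_
  simp only [eval_pow, Pi.zero_apply]
  positivity

lemma gaussI_one_pos : 0 < gaussI 1 := by
  have h := integral_gaussian 1
  simp only [gaussI_apply, eval_one, one_mul]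
  simp only [neg_mul, one_mul, div_one] at h
  rw [h]
  exact Real.sqrt_pos.2 Real.pi_pos

/-- Integration by parts against the Gaussian weight. -/
lemma gaussI_derivative (Q : ℝ[X]) : gaussI (derivative Q) = 2 * gaussI (X * Q) := by
  have h : ∀ x : ℝ, HasDerivAt (fun x => Q.eval x * Real.exp (-x ^ 2))
      ((derivative Q - 2 * X * Q).eval x * Real.exp (-x ^ 2)) x := fun x => by
    have h1 : HasDerivAt (fun y : ℝ => Real.exp (-y ^ 2)) (Real.exp (-x ^ 2) * -(2 * x)) x := by
      simpa using ((hasDerivAt_pow 2 x).fun_neg).exp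
    refine ((Q.hasDerivAt x).mul h1).congr_deriv ?_
    simp
    ring
  have h0 := integral_eq_zero_of_hasDerivAt_of_integrable h (integrable_poly_gauss _)
    (integrable_poly_gauss _)
  rw [← gaussI_apply, map_sub, show (2 : ℝ[X]) * X * Q = (2 : ℝ) • (X * Q) by
    rw [smul_eq_C_mul, mul_assoc]; rfl, map_smul, smul_eq_mul] at h0
  linarith

/-! ### Hermite polynomials and the harmonic oscillator -/

/-- The Hermite polynomials, by the recursion `H_{n+1} = 2 y H_n - H_n'`. -/
def hermPoly : ℕ → ℝ[X]
  | 0 => 1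
  | n + 1 => C 2 * X * hermPoly n - derivative (hermPoly n)

/-- The Hermite differential operator `Q ↦ 2 y Q' - Q''`. -/
def hermOp : ℝ[X] →ₗ[ℝ] ℝ[X] :=
  LinearMap.mulLeft ℝ (C 2 * X) ∘ₗ derivative - derivative ∘ₗ derivative

lemma hermOp_apply (Q : ℝ[X]) :
    hermOp Q = C 2 * X * derivative Q - derivative (derivative Q) := rfl

/-- The raising operator `A Q = 2 y Q - Q'` satisfies `[Q ↦ 2 y Q' - Q'', A] = 2 A`, hence it maps
eigenvectors to eigenvectors. -/
lemma hermOp_hermPoly (n : ℕ) : hermOp (hermPoly n) = (2 * n : ℝ) • hermPoly n := by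
  induction n with
  | zero => simp [hermOp_apply, hermPoly]
  | succ n ih =>
    have h2 := congrArg derivative ih
    simp only [hermOp_apply, smul_eq_C_mul, derivative_sub, derivative_mul, derivative_C,
      derivative_X, zero_mul, mul_one, zero_add] at ih h2
    simp only [hermOp_apply, hermPoly, smul_eq_C_mul, derivative_sub, derivative_mul, derivative_C,
      derivative_X, zero_mul, mul_one, zero_add, derivative_add]
    push_cast
    simp only [mul_add, map_add, map_mul, mul_one] at *
    linear_combination C 2 * X * ih - h2

/-- The Hermite operator is the form `∫ Q' R' e^{-y²}`. -/
lemma gaussI_hermOp (Q R : ℝ[X]) :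
    gaussI (hermOp Q * R) = gaussI (derivative Q * derivative R) := by
  have h := gaussI_derivative (derivative Q * R)
  rw [derivative_mul, map_add] at h
  have : hermOp Q * R = (2 : ℝ) • (X * (derivative Q * R)) - derivative (derivative Q) * R := by
    rw [hermOp_apply, smul_eq_C_mul]; ring
  rw [this, map_sub, map_smul, smul_eq_mul]
  linarith

lemma gaussI_hermPoly_mul {m n : ℕ} (h : m ≠ n) : gaussI (hermPoly m * hermPoly n) = 0 := by
  have h1 := gaussI_hermOp (hermPoly m) (hermPoly n)
  have h2 := gaussI_hermOp (hermPoly n) (hermPoly m)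
  rw [hermOp_hermPoly, smul_mul_assoc, map_smul, smul_eq_mul] at h1 h2
  rw [mul_comm (hermPoly n), mul_comm (derivative (hermPoly n)), ← h1] at h2
  have h3 : (n - m : ℝ) ≠ 0 := sub_ne_zero.2 (by exact_mod_cast h.symm)
  refine (mul_eq_zero.1 ?_).resolve_left h3
  linear_combination h2 / 2

lemma gaussI_sum_mul_sum (n : ℕ) (c d : Fin n → ℝ) :
    gaussI ((∑ i, c i • hermPoly i) * ∑ i, d i • hermPoly i)
      = ∑ i, c i * d i * gaussI (hermPoly i ^ 2) := by
  rw [Finset.sum_mul_sum, map_sum]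
  refine Finset.sum_congr rfl fun i _ => ?_
  rw [map_sum, Finset.sum_eq_single i]
  · rw [smul_mul_smul_comm, map_smul, smul_eq_mul, pow_two]
  · intro j _ hj
    rw [smul_mul_smul_comm, map_smul, gaussI_hermPoly_mul (fun h => hj (Fin.ext h.symm)), smul_zero]
  · simp

/-- The span of the Hermite polynomials `H_0, …, H_N`. -/
def hermSpan (N : ℕ) : Submodule ℝ ℝ[X] :=
  Submodule.span ℝ (range fun i : Fin (N + 1) => hermPoly i)

lemma hermSpan_mono {N N' : ℕ} (h : N ≤ N') : hermSpan N ≤ hermSpan N' := by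
  refine Submodule.span_mono ?_
  rintro _ ⟨i, rfl⟩
  exact ⟨⟨i, by omega⟩, rfl⟩

lemma gaussI_derivative_sq_le {N : ℕ} {Q : ℝ[X]} (hQ : Q ∈ hermSpan N) :
    gaussI (derivative Q ^ 2) ≤ 2 * N * gaussI (Q ^ 2) := by
  obtain ⟨c, rfl⟩ := (Submodule.mem_span_range_iff_exists_fun ℝ).1 hQ
  have h : hermOp (∑ i, c i • hermPoly i) = ∑ i : Fin (N + 1), (c i * (2 * i)) • hermPoly i := by
    simp only [map_sum, map_smul, hermOp_hermPoly, smul_smul]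
  rw [pow_two, ← gaussI_hermOp, h, gaussI_sum_mul_sum, pow_two, gaussI_sum_mul_sum,
    Finset.mul_sum]
  refine Finset.sum_le_sum fun i _ => ?_
  have h1 : (i : ℝ) ≤ N := by exact_mod_cast Nat.lt_succ_iff.1 i.2
  have h2 := mul_nonneg (mul_self_nonneg (c i)) (gaussI_sq_nonneg (hermPoly i))
  nlinarith

lemma gaussI_hermOp_add_sq_le {N : ℕ} {Q : ℝ[X]} (hQ : Q ∈ hermSpan N) :
    gaussI ((hermOp Q + Q) ^ 2) ≤ (2 * N + 1) ^ 2 * gaussI (Q ^ 2) := by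
  obtain ⟨c, rfl⟩ := (Submodule.mem_span_range_iff_exists_fun ℝ).1 hQ
  have h : hermOp (∑ i, c i • hermPoly i) + ∑ i, c i • hermPoly i
      = ∑ i : Fin (N + 1), (c i * (2 * i + 1)) • hermPoly i := by
    simp only [map_sum, map_smul, hermOp_hermPoly, smul_smul, ← Finset.sum_add_distrib, ← add_smul,
      mul_add, mul_one]
  rw [h, pow_two, gaussI_sum_mul_sum, pow_two (∑ i, _), gaussI_sum_mul_sum, Finset.mul_sum]
  refine Finset.sum_le_sum fun i _ => ?_
  have h1 : (i : ℝ) ≤ N := by exact_mod_cast Nat.lt_succ_iff.1 i.2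
  have h0 : (0 : ℝ) ≤ i := by positivity
  have h2 := mul_nonneg (mul_self_nonneg (c i)) (gaussI_sq_nonneg (hermPoly i))
  have h3 : (2 * (i : ℝ) + 1) ^ 2 ≤ (2 * N + 1) ^ 2 := by gcongr
  nlinarith

/-! ### Inverse inequalities for polynomials with Gaussian weight -/

/-- `(Q e^{-y²/2})' = (gaussDeriv Q) e^{-y²/2}`. -/
def gaussDeriv (Q : ℝ[X]) : ℝ[X] := derivative Q - X * Q

lemma gaussI_mul_X_sq (Q : ℝ[X]) :
    gaussI (Q ^ 2) + 2 * gaussI (X * Q * derivative Q) = 2 * gaussI (X ^ 2 * Q ^ 2) := by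
  have h := gaussI_derivative (X * Q ^ 2)
  rw [show derivative (X * Q ^ 2) = Q ^ 2 + (2 : ℝ) • (X * Q * derivative Q) by
    rw [smul_eq_C_mul, derivative_mul, derivative_X, derivative_sq]; ring,
    show X * (X * Q ^ 2) = X ^ 2 * Q ^ 2 by ring, map_add, map_smul, smul_eq_mul] at h
  exact h

/-- Inverse inequality for `∂_y`: with `U = Q e^{-y²/2}` one has
`‖U'‖² + ‖y U‖² = ‖Q' e^{-y²/2}‖² + ‖U‖²`. -/
lemma gaussI_gaussDeriv_sq_le {N : ℕ} {Q : ℝ[X]} (hQ : Q ∈ hermSpan N) :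
    gaussI (gaussDeriv Q ^ 2) ≤ (2 * N + 1) * gaussI (Q ^ 2) := by
  have h1 := gaussI_derivative_sq_le hQ
  have h2 := gaussI_mul_X_sq Q
  have h3 := gaussI_sq_nonneg (X * Q)
  rw [mul_pow] at h3
  have h4 : gaussDeriv Q ^ 2
      = derivative Q ^ 2 - (2 : ℝ) • (X * Q * derivative Q) + X ^ 2 * Q ^ 2 := by
    rw [smul_eq_C_mul, gaussDeriv, show (C 2 : ℝ[X]) = 2 from rfl]; ring
  rw [h4, map_add, map_sub, map_smul, smul_eq_mul]
  linarith

/-- Inverse inequality for `y ∂_y`.  With `U = Q e^{-y²/2}` and the harmonic oscillator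
`H U = -U'' + y² U` one has `2 ‖y U'‖² = ‖H U‖² + 2 ‖U‖² - ‖U''‖² - ‖y² U‖²`; this suffices unless
`N = 0`, where `U` is a multiple of the Gaussian. -/
lemma gaussI_X_gaussDeriv_sq_le {N : ℕ} {Q : ℝ[X]} (hQ : Q ∈ hermSpan N) :
    gaussI ((X * gaussDeriv Q) ^ 2) ≤ (2 * N + 1) ^ 2 * gaussI (Q ^ 2) := by
  have hc2 : (C 2 : ℝ[X]) = 2 := rfl
  rcases Nat.eq_zero_or_pos N with rfl | hN
  · obtain ⟨c, rfl⟩ := (Submodule.mem_span_range_iff_exists_fun ℝ).1 hQ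
    have h2 := gaussI_mul_X_sq 1
    have h3 := gaussI_mul_X_sq X
    simp only [derivative_one, derivative_X, mul_zero, map_zero, one_pow, mul_one, add_zero]
      at h2 h3
    rw [← pow_two, ← pow_add] at h3
    have h4 : (X * gaussDeriv (∑ i : Fin (0 + 1), c i • hermPoly i)) ^ 2
        = (c 0 ^ 2) • (X ^ 4 : ℝ[X]) := by
      simp [gaussDeriv, hermPoly, smul_eq_C_mul]; ring
    have h5 : (∑ i : Fin (0 + 1), c i • hermPoly i) ^ 2 = (c 0 ^ 2) • (1 : ℝ[X]) := by
      simp [hermPoly, smul_eq_C_mul]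
    rw [h4, h5, map_smul, map_smul, smul_eq_mul, smul_eq_mul]
    have := mul_nonneg (sq_nonneg (c 0)) gaussI_one_pos.le
    norm_num at h3 ⊢
    nlinarith
  · have h1 := gaussI_hermOp_add_sq_le hQ
    set D := gaussDeriv Q with hD
    set D2 := gaussDeriv D with hD2
    have h2 : hermOp Q + Q = X ^ 2 * Q - D2 := by
      simp only [hD2, hD, gaussDeriv, hermOp_apply, derivative_sub, derivative_mul, derivative_X,
        hc2]
      ring
    -- integrating the derivatives of `y² U U'` and `y U²` relates `‖y U'‖²` to `(y² U, U'')`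
    have h3 := gaussI_derivative (X ^ 2 * Q * D)
    have h4 := gaussI_derivative (X * Q ^ 2)
    have h5 : derivative (X ^ 2 * Q * D)
        = (2 : ℝ) • (X * (X ^ 2 * Q * D)) + (2 : ℝ) • (X * Q * D) + (X * D) ^ 2
          + X ^ 2 * Q * D2 := by
      simp only [hD2, hD, gaussDeriv, derivative_sub, derivative_mul, derivative_X, smul_eq_C_mul,
        hc2, derivative_X_pow]
      simp only [Nat.cast_ofNat, hc2, Nat.add_one_sub_one, pow_one]
      ring
    have h6 : derivative (X * Q ^ 2) = (2 : ℝ) • (X * (X * Q ^ 2)) + Q ^ 2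
        + (2 : ℝ) • (X * Q * D) := by
      simp only [hD, gaussDeriv, derivative_mul, derivative_X, smul_eq_C_mul,
        hc2, derivative_sq]
      ring
    have h7 : (X ^ 2 * Q - D2) ^ 2
        = (X ^ 2 * Q) ^ 2 - (2 : ℝ) • (X ^ 2 * Q * D2) + D2 ^ 2 := by
      rw [smul_eq_C_mul, hc2]; ring
    rw [h5] at h3
    rw [h6] at h4
    rw [h2, h7] at h1
    simp only [map_add, map_sub, map_smul, smul_eq_mul] at h1 h3 h4
    have h8 := gaussI_sq_nonneg (X ^ 2 * Q)
    have h9 := gaussI_sq_nonneg D2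
    have h10 := gaussI_sq_nonneg Q
    have h11 : (1 : ℝ) ≤ N := by exact_mod_cast hN
    nlinarith [mul_nonneg h10 (sub_nonneg.2 h11)]

/-! ### Hermite functions as polynomials times Gaussians -/

lemma isWeakDeriv_polyGauss (p : Params) (Q : ℝ[X]) :
    IsWeakDeriv (polyGauss p Q) (polyGauss p (C p.β * gaussDeriv Q)) := by
  intro φ hφ hc
  have hd : Differentiable ℝ φ := hφ.differentiable (by simp)
  have h1 := memLp_of_test hφ.continuous hc
  have h2 := memLp_of_test (hφ.continuous_deriv (by simp)) hc.deriv
  exact integral_mul_deriv_eq_deriv_mul_of_integrable (fun x _ => polyGauss_hasDerivAt p Q x)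
    (fun x _ => (hd x).hasDerivAt) ((polyGauss_memLp p Q).integrable_mul h2)
    ((polyGauss_memLp p _).integrable_mul h1) ((polyGauss_memLp p Q).integrable_mul h1)

lemma polyGauss_add (p : Params) (Q R : ℝ[X]) :
    polyGauss p (Q + R) = polyGauss p Q + polyGauss p R := by
  funext x; simp [polyGauss, add_mul]

lemma polyGauss_smul (p : Params) (c : ℝ) (Q : ℝ[X]) :
    polyGauss p (c • Q) = c • polyGauss p Q := by
  funext x; simp [polyGauss, mul_assoc]

lemma isWeakDeriv_congr_ae {f f' g g' : ℝ → ℝ} (h : f =ᵐ[volume] g) (h' : f' =ᵐ[volume] g')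
    (hg : IsWeakDeriv g g') : IsWeakDeriv f f' := by
  intro φ hφ hc
  refine (integral_congr_ae (h.mul (ae_eq_refl (deriv φ)))).trans ((hg φ hφ hc).trans ?_)
  exact congrArg Neg.neg (integral_congr_ae (h'.mul (ae_eq_refl φ))).symm

/-- The function `polyGauss p Q` as an element of `H¹(ℝ)`, linearly in the polynomial `Q`. -/
def polyGaussH1 (p : Params) : ℝ[X] →ₗ[ℝ] H1 where
  toFun Q := ⟨WithLp.toLp 2 ((polyGauss_memLp p Q).toLp _,
    (polyGauss_memLp p (C p.β * gaussDeriv Q)).toLp _),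
    isWeakDeriv_congr_ae (polyGauss_memLp p Q).coeFn_toLp (polyGauss_memLp p _).coeFn_toLp
      (isWeakDeriv_polyGauss p Q)⟩
  map_add' Q R := by
    refine toL2_injective ?_
    exact (MemLp.toLp_congr (polyGauss_memLp p _) _ (by rw [polyGauss_add])).trans
      (MemLp.toLp_add (polyGauss_memLp p Q) (polyGauss_memLp p R))
  map_smul' c Q := by
    refine toL2_injective ?_
    exact (MemLp.toLp_congr (polyGauss_memLp p _) _ (by rw [polyGauss_smul])).trans
      (MemLp.toLp_const_smul c (polyGauss_memLp p Q))

lemma toL2_polyGaussH1 (p : Params) (Q : ℝ[X]) :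
    toL2 (polyGaussH1 p Q) = (polyGauss_memLp p Q).toLp _ := rfl

lemma dx_polyGaussH1 (p : Params) (Q : ℝ[X]) :
    dx (polyGaussH1 p Q) = (polyGauss_memLp p (C p.β * gaussDeriv Q)).toLp _ := rfl

/-- The definition of the Hermite polynomials by derivatives of `e^{-x²}` agrees with the
recursion. -/
lemma iteratedDeriv_gaussian (i : ℕ) (x : ℝ) :
    iteratedDeriv i (fun y : ℝ => Real.exp (-y ^ 2)) x
      = (-1) ^ i * (hermPoly i).eval x * Real.exp (-x ^ 2) := by
  induction i generalizing x with
  | zero => simp [hermPoly]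
  | succ n ih =>
    rw [iteratedDeriv_succ, funext ih]
    have h1 : HasDerivAt (fun y : ℝ => Real.exp (-y ^ 2)) (Real.exp (-x ^ 2) * -(2 * x)) x := by
      simpa using ((hasDerivAt_pow 2 x).fun_neg).exp
    have h2 : HasDerivAt (fun x => (-1) ^ n * (hermPoly n).eval x * Real.exp (-x ^ 2)) _ x :=
      (((hermPoly n).hasDerivAt x).const_mul _).mul h1
    rw [h2.deriv]
    simp [hermPoly]
    ring

lemma hermiteFun_eq_polyGauss (p : Params) (i : ℕ) :
    hermiteFun p i = polyGauss p ((1 / √(2 ^ i * (i.factorial : ℝ))) • hermPoly i) := by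
  funext x
  simp only [hermiteFun, hermiteH, iteratedDeriv_gaussian, polyGauss, eval_smul, smul_eq_mul]
  have h1 : Real.exp ((p.β * (x - p.x₀)) ^ 2) * Real.exp (-(p.β * (x - p.x₀)) ^ 2) = 1 := by
    rw [← Real.exp_add]; simp
  have h2 : ((-1 : ℝ) ^ i) * (-1) ^ i = 1 := by rw [← mul_pow]; simp
  linear_combination (1 / √(2 ^ i * (i.factorial : ℝ)) * (hermPoly i).eval (p.β * (x - p.x₀))
    * Real.exp (-(p.β * (x - p.x₀)) ^ 2 / 2)) * ((-1) ^ i * (-1) ^ i * h1 + h2)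

lemma hermiteH1_eq (p : Params) (i : ℕ) :
    hermiteH1 p i = (1 / √(2 ^ i * (i.factorial : ℝ))) • polyGaussH1 p (hermPoly i) := by
  rw [← map_smul]
  refine toL2_injective ?_
  rw [toL2_polyGaussH1]
  exact MemLp.toLp_congr (hermiteFun_memLp p i) _ (by rw [hermiteFun_eq_polyGauss])

/-- The Hermite space consists of the functions `Q(β(x-x₀)) e^{-β²(x-x₀)²/2}` with a polynomial `Q`
from a space that does not depend on `β` and `x₀`. -/
lemma P_eq_map (p : Params) : P p = (hermSpan p.N).map (polyGaussH1 p) := by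
  have hpos : ∀ i : ℕ, 1 / √(2 ^ i * (i.factorial : ℝ)) ≠ 0 := fun i => by
    have : (0 : ℝ) < i.factorial := by exact_mod_cast i.factorial_pos
    positivity
  rw [P, hermSpan, Submodule.map_span]
  refine le_antisymm (Submodule.span_le.2 ?_) (Submodule.span_le.2 ?_)
  · rintro _ ⟨i, rfl⟩
    simp only [hermiteH1_eq]
    exact Submodule.smul_mem _ _ (Submodule.subset_span ⟨_, ⟨i, rfl⟩, rfl⟩)
  · rintro _ ⟨_, ⟨i, rfl⟩, rfl⟩
    have := Submodule.smul_mem (Submodule.span ℝ (range fun i : Fin (p.N + 1) => hermiteH1 p i))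
      (1 / √(2 ^ (i : ℕ) * ((i : ℕ).factorial : ℝ)))⁻¹ (Submodule.subset_span ⟨i, rfl⟩)
    simpa only [hermiteH1_eq, smul_smul, inv_mul_cancel₀ (hpos _), one_smul,
      SetLike.mem_coe] using this

lemma mem_P_iff {p : Params} {U : H1} : U ∈ P p ↔ ∃ Q ∈ hermSpan p.N, polyGaussH1 p Q = U := by
  rw [P_eq_map, Submodule.mem_map]

/-! ### Norms in the Hermite space and inverse inequalities -/

lemma integral_polyGauss_sq (p : Params) (Q : ℝ[X]) :
    ∫ x, polyGauss p Q x ^ 2 = p.β⁻¹ * gaussI (Q ^ 2) := by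
  have h := integral_sub_right_eq_self (μ := (volume : Measure ℝ))
    (fun x => (fun y : ℝ => (Q ^ 2).eval y * Real.exp (-y ^ 2)) (p.β * x)) p.x₀
  rw [Measure.integral_comp_mul_left (fun y : ℝ => (Q ^ 2).eval y * Real.exp (-y ^ 2)),
    abs_of_pos (inv_pos.2 p.β_pos), smul_eq_mul] at h
  rw [gaussI_apply, ← h]
  congr 1
  funext x
  simp only [polyGauss, eval_pow, mul_pow, ← Real.exp_nat_mul]
  congr 2
  push_cast
  ring

lemma norm_sq_toLp {μ : Measure ℝ} {f : ℝ → ℝ} (hf : MemLp f 2 μ) :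
    ‖hf.toLp f‖ ^ 2 = ∫ x, f x ^ 2 ∂μ := by
  rw [← real_inner_self_eq_norm_sq, L2.inner_def]
  refine integral_congr_ae ?_
  filter_upwards [hf.coeFn_toLp] with x hx
  simp [hx, pow_two]

lemma norm_sq_toL2_polyGaussH1 (p : Params) (Q : ℝ[X]) :
    ‖toL2 (polyGaussH1 p Q)‖ ^ 2 = p.β⁻¹ * gaussI (Q ^ 2) := by
  rw [toL2_polyGaussH1, norm_sq_toLp, integral_polyGauss_sq]

lemma norm_sq_dx_polyGaussH1 (p : Params) (Q : ℝ[X]) :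
    ‖dx (polyGaussH1 p Q)‖ ^ 2 = p.β * gaussI (gaussDeriv Q ^ 2) := by
  rw [dx_polyGaussH1, norm_sq_toLp, integral_polyGauss_sq, mul_pow, ← C_pow, ← smul_eq_C_mul,
    map_smul, smul_eq_mul]
  field_simp [p.β_pos.ne']

lemma normXDx_polyGaussH1_sq (p : Params) (Q : ℝ[X]) :
    normXDx p.x₀ (polyGaussH1 p Q) ^ 2 = p.β⁻¹ * gaussI ((X * gaussDeriv Q) ^ 2) := by
  have hm := polyGauss_memLp p (X * gaussDeriv Q)
  have h : (fun x => (x - p.x₀) * dx (polyGaussH1 p Q) x)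
      =ᵐ[volume] polyGauss p (X * gaussDeriv Q) := by
    rw [dx_polyGaussH1]
    filter_upwards [(polyGauss_memLp p (C p.β * gaussDeriv Q)).coeFn_toLp] with x hx
    rw [hx]
    simp [polyGauss]
    ring
  rw [normXDx, eLpNorm_congr_ae h, ← integral_polyGauss_sq, ← norm_sq_toLp hm, Lp.norm_toLp]

/-- `‖(x - x₀) ∂ₓU‖ ≤ (2N+1) ‖U‖` on the Hermite space. -/
lemma normXDx_le {p : Params} {U : H1} (hU : U ∈ P p) :
    normXDx p.x₀ U ≤ (2 * p.N + 1) * ‖toL2 U‖ := by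
  obtain ⟨Q, hQ, rfl⟩ := mem_P_iff.1 hU
  refine le_of_sq_le_sq ?_ (by positivity)
  rw [mul_pow, normXDx_polyGaussH1_sq, norm_sq_toL2_polyGaussH1, mul_left_comm]
  exact mul_le_mul_of_nonneg_left (gaussI_X_gaussDeriv_sq_le hQ) (inv_nonneg.2 p.β_pos.le)

/-- `‖∂ₓU‖ ≤ (2N+1)^{1/2} β ‖U‖` on the Hermite space. -/
lemma norm_dx_le {p : Params} {U : H1} (hU : U ∈ P p) :
    ‖dx U‖ ≤ √(2 * p.N + 1) * p.β * ‖toL2 U‖ := by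
  obtain ⟨Q, hQ, rfl⟩ := mem_P_iff.1 hU
  have hβ := p.β_pos
  refine le_of_sq_le_sq ?_ (by positivity)
  rw [mul_pow, mul_pow, norm_sq_dx_polyGaussH1, norm_sq_toL2_polyGaussH1,
    Real.sq_sqrt (by positivity)]
  calc p.β * gaussI (gaussDeriv Q ^ 2) ≤ p.β * ((2 * p.N + 1) * gaussI (Q ^ 2)) :=
        mul_le_mul_of_nonneg_left (gaussI_gaussDeriv_sq_le hQ) hβ.le
    _ = _ := by field_simp

/-! ### Changing the parameters of a Hermite function -/

/-- `‖F(b, ·) - F(a, ·)‖² ≤ (b - a) ∫ₐᵇ ‖∂ₛF(s, ·)‖² ds` in `L²(ℝ)`. -/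
lemma lintegral_sub_sq_le {F G : ℝ → ℝ → ℝ} {a b M : ℝ} (hab : a ≤ b)
    (hF : ∀ s ∈ Icc a b, ∀ x, HasDerivAt (fun r => F r x) (G s x) s)
    (hG : Continuous (Function.uncurry G)) {c : ℝ → ℝ}
    (hc : ∀ s ∈ Icc a b, ∫⁻ x, ENNReal.ofReal (G s x ^ 2) ≤ ENNReal.ofReal (c s))
    (hM : ∫⁻ s in Icc a b, ENNReal.ofReal (c s) ≤ ENNReal.ofReal M) :
    ∫⁻ x, ENNReal.ofReal ((F b x - F a x) ^ 2) ≤ ENNReal.ofReal ((b - a) * M) := by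
  have hGx : ∀ x, Continuous fun s => G s x := fun x => hG.comp (Continuous.prodMk_left x)
  have hpt : ∀ x, ENNReal.ofReal ((F b x - F a x) ^ 2)
      ≤ ENNReal.ofReal (b - a) * ∫⁻ s in Icc a b, ENNReal.ofReal (G s x ^ 2) := by
    intro x
    have hi : IntegrableOn (fun s => G s x ^ 2) (Icc a b) :=
      ((hGx x).pow 2).continuousOn.integrableOn_Icc
    have h1 : ∫ s in a..b, G s x = F b x - F a x :=
      intervalIntegral.integral_eq_sub_of_hasDerivAt
        (fun s hs => hF s (by rwa [uIcc_of_le hab] at hs) x) ((hGx x).intervalIntegrable _ _)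
    rw [← ofReal_integral_eq_lintegral_ofReal hi
      (ae_of_all _ fun s => sq_nonneg _), ← ENNReal.ofReal_mul (sub_nonneg.2 hab)]
    refine ENNReal.ofReal_le_ofReal ?_
    rw [← h1, integral_Icc_eq_integral_Ioc, ← intervalIntegral.integral_of_le hab]
    -- Cauchy-Schwarz, from the nonnegativity of `∫ (G - m)²` with the mean value `m`
    set m := ∫ s in a..b, G s x with hm
    rcases hab.eq_or_lt with rfl | hlt
    · simp [hm]
    have hg2 : IntervalIntegrable (fun s => G s x ^ 2) volume a b :=
      ((hGx x).pow 2).intervalIntegrable _ _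
    have hg1 : IntervalIntegrable (fun s => 2 * (m / (b - a)) * G s x) volume a b :=
      (continuous_const.mul (hGx x)).intervalIntegrable _ _
    have h2 : 0 ≤ ∫ s in a..b, (G s x - m / (b - a)) ^ 2 :=
      intervalIntegral.integral_nonneg hab fun s _ => sq_nonneg _
    have h3 : (fun s => (G s x - m / (b - a)) ^ 2)
        = fun s => G s x ^ 2 - 2 * (m / (b - a)) * G s x + (m / (b - a)) ^ 2 := by
      funext s; ring
    have hpos := sub_pos.2 hlt
    rw [h3, intervalIntegral.integral_add (hg2.sub hg1) (by simp),
      intervalIntegral.integral_sub hg2 hg1, intervalIntegral.integral_const_mul, ← hm,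
      intervalIntegral.integral_const, smul_eq_mul] at h2
    have h4 := mul_nonneg hpos.le h2
    have h5 : (b - a) * ((∫ s in a..b, G s x ^ 2) - 2 * (m / (b - a)) * m
        + (b - a) * (m / (b - a)) ^ 2) = (b - a) * (∫ s in a..b, G s x ^ 2) - m ^ 2 := by
      field_simp; ring
    linarith
  calc ∫⁻ x, ENNReal.ofReal ((F b x - F a x) ^ 2)
      ≤ ∫⁻ x, ENNReal.ofReal (b - a) * ∫⁻ s in Icc a b, ENNReal.ofReal (G s x ^ 2) :=
        lintegral_mono hpt
    _ = ENNReal.ofReal (b - a) * ∫⁻ s in Icc a b, ∫⁻ x, ENNReal.ofReal (G s x ^ 2) := by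
        rw [lintegral_const_mul' _ _ ENNReal.ofReal_ne_top, lintegral_lintegral_swap]
        have h : Continuous (Function.uncurry fun x s => G s x) := hG.comp continuous_swap
        exact ((h.pow 2).measurable.ennreal_ofReal).aemeasurable
    _ ≤ ENNReal.ofReal (b - a) * ENNReal.ofReal M := by
        gcongr
        exact (setLIntegral_mono' measurableSet_Icc hc).trans hM
    _ = ENNReal.ofReal ((b - a) * M) := (ENNReal.ofReal_mul (sub_nonneg.2 hab)).symm

lemma lintegral_polyGauss_sq (p : Params) (Q : ℝ[X]) :
    ∫⁻ x, ENNReal.ofReal (polyGauss p Q x ^ 2) = ENNReal.ofReal (p.β⁻¹ * gaussI (Q ^ 2)) := by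
  rw [← integral_polyGauss_sq, ofReal_integral_eq_lintegral_ofReal
    (polyGauss_memLp p Q).integrable_sq (ae_of_all _ fun x => sq_nonneg _)]

lemma norm_sub_polyGaussH1_sq_le {p q : Params} {Q R : ℝ[X]} {M : ℝ} (hM : 0 ≤ M)
    (h : ∫⁻ x, ENNReal.ofReal ((polyGauss p Q x - polyGauss q R x) ^ 2) ≤ ENNReal.ofReal M) :
    ‖toL2 (polyGaussH1 p Q) - toL2 (polyGaussH1 q R)‖ ^ 2 ≤ M := by
  have hm := (polyGauss_memLp p Q).sub (polyGauss_memLp q R)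
  rw [toL2_polyGaussH1, toL2_polyGaussH1, ← MemLp.toLp_sub, norm_sq_toLp,
    ← ENNReal.ofReal_le_ofReal_iff hM, ofReal_integral_eq_lintegral_ofReal
    hm.integrable_sq (ae_of_all _ fun x => sq_nonneg _)]
  exact h

/-- Effect of changing the displacement: the derivative in the displacement is `-∂ₓ`, whose norm on
the translates is constant. -/
lemma norm_sub_move_le {p q : Params} (hβ : q.β = p.β) (Q : ℝ[X]) :
    ‖toL2 (polyGaussH1 p Q) - toL2 (polyGaussH1 q Q)‖
      ≤ |p.x₀ - q.x₀| * ‖dx (polyGaussH1 p Q)‖ := by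
  suffices H : ∀ p q : Params, q.β = p.β → p.x₀ ≤ q.x₀ →
      ‖toL2 (polyGaussH1 q Q) - toL2 (polyGaussH1 p Q)‖ ^ 2
        ≤ (q.x₀ - p.x₀) * ((q.x₀ - p.x₀) * (p.β * gaussI (gaussDeriv Q ^ 2))) by
    refine le_of_sq_le_sq ?_ (by positivity)
    rw [mul_pow, norm_sq_dx_polyGaussH1, sq_abs]
    rcases le_total p.x₀ q.x₀ with h | h
    · have := H p q hβ h
      rw [norm_sub_rev]
      linarith
    · have := H q p hβ.symm h
      rw [hβ] at this
      linarith
  intro p q hβ hx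
  have hI := mul_nonneg p.β_pos.le (gaussI_sq_nonneg (gaussDeriv Q))
  have hx' := sub_nonneg.2 hx
  refine norm_sub_polyGaussH1_sq_le (mul_nonneg hx' (mul_nonneg hx' hI)) ?_
  have key := lintegral_sub_sq_le (F := fun s x => polyGauss ⟨p.N, p.β, s, p.β_pos⟩ Q x)
    (G := fun s x => -polyGauss ⟨p.N, p.β, s, p.β_pos⟩ (C p.β * gaussDeriv Q) x)
    (c := fun _ => p.β * gaussI (gaussDeriv Q ^ 2))
    (M := (q.x₀ - p.x₀) * (p.β * gaussI (gaussDeriv Q ^ 2))) hx ?_ ?_ ?_ ?_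
  · refine le_trans (le_of_eq ?_) key
    simp only [polyGauss, hβ]
  · intro s _ x
    -- the function depends on `x - s` only
    have h := polyGauss_hasDerivAt ⟨p.N, p.β, 0, p.β_pos⟩ Q (x - s)
    have h2 : HasDerivAt (fun r : ℝ => x - r) (-1) s := by
      simpa using (hasDerivAt_id s).const_sub x
    refine ((h.comp s h2).congr_deriv ?_).congr_of_eventuallyEq (.of_forall fun r => ?_)
    · simp [polyGauss, gaussDeriv]
    · simp [polyGauss]
  · have h1 := (C p.β * gaussDeriv Q).continuous
    simp only [polyGauss, Function.uncurry_def]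
    fun_prop
  · intro s _
    simp only [neg_sq]
    rw [lintegral_polyGauss_sq, mul_pow, ← C_pow, ← smul_eq_C_mul, map_smul, smul_eq_mul]
    refine ENNReal.ofReal_le_ofReal (le_of_eq ?_)
    have := p.β_pos.ne'
    simp only
    field_simp
  · rw [setLIntegral_const, Real.volume_Icc, mul_comm, ← ENNReal.ofReal_mul hx']

/-- Effect of changing the scaling factor from `β` to `β'`.  The derivative of the function in the
scaling factor `s` has the squared norm `s⁻³ I`, where `β⁻¹ I = ‖(x - x₀) ∂ₓU‖²`, and
`scaleFactor β β' ^ 2 = β |β' - β| |∫ s⁻³ ds|` with the integral from `β` to `β'`. -/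
lemma norm_sub_scale_le {p q : Params} (hx : q.x₀ = p.x₀) (Q : ℝ[X]) :
    ‖toL2 (polyGaussH1 p Q) - toL2 (polyGaussH1 q Q)‖
      ≤ scaleFactor p.β q.β * normXDx p.x₀ (polyGaussH1 p Q) := by
  suffices H : ∀ p q : Params, q.x₀ = p.x₀ → p.β ≤ q.β →
      ‖toL2 (polyGaussH1 q Q) - toL2 (polyGaussH1 p Q)‖ ^ 2
        ≤ (q.β - p.β) * (gaussI ((X * gaussDeriv Q) ^ 2) * (1 / p.β ^ 2 - 1 / q.β ^ 2) / 2) by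
    have h1 := p.β_pos
    have h2 := q.β_pos
    refine le_of_sq_le_sq ?_ (mul_nonneg (by unfold scaleFactor; positivity) ENNReal.toReal_nonneg)
    rw [mul_pow, normXDx_polyGaussH1_sq]
    have h3 : scaleFactor p.β q.β ^ 2 * (p.β⁻¹ * gaussI ((X * gaussDeriv Q) ^ 2))
        = (q.β - p.β) * (gaussI ((X * gaussDeriv Q) ^ 2) * (1 / p.β ^ 2 - 1 / q.β ^ 2) / 2) := by
      rw [scaleFactor, div_pow, mul_pow, mul_pow, sq_abs, Real.sq_sqrt (by positivity),
        Real.sq_sqrt (by positivity)]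
      field_simp
      ring
    rw [h3]
    rcases le_total p.β q.β with h | h
    · rw [norm_sub_rev]
      exact H p q hx h
    · have := H q p hx.symm h
      linarith
  intro p q hx hβ
  have hI := gaussI_sq_nonneg (X * gaussDeriv Q)
  have hp := p.β_pos
  have hq := q.β_pos
  have hM : 0 ≤ (1 / p.β ^ 2 - 1 / q.β ^ 2) :=
    sub_nonneg.2 (one_div_le_one_div_of_le (by positivity) (by gcongr))
  refine norm_sub_polyGaussH1_sq_le (mul_nonneg (sub_nonneg.2 hβ) (by positivity)) ?_
  refine lintegral_sub_sq_le (F := fun s x => Q.eval (s * (x - p.x₀))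
      * Real.exp (-(s * (x - p.x₀)) ^ 2 / 2))
    (G := fun s x => (x - p.x₀) * ((gaussDeriv Q).eval (s * (x - p.x₀))
      * Real.exp (-(s * (x - p.x₀)) ^ 2 / 2)))
    (c := fun s => gaussI ((X * gaussDeriv Q) ^ 2) * (s ^ 3)⁻¹) hβ ?_ ?_ ?_ ?_
      |> le_trans (le_of_eq ?_)
  · simp only [polyGauss, hx]
  · intro s _ x
    -- the function depends on `s (x - x₀)` only
    have h := polyGauss_hasDerivAt ⟨p.N, 1, 0, one_pos⟩ Q (s * (x - p.x₀))
    have h2 : HasDerivAt (fun r : ℝ => r * (x - p.x₀)) (x - p.x₀) s := by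
      simpa using (hasDerivAt_id s).mul_const (x - p.x₀)
    refine ((h.comp s h2).congr_deriv ?_).congr_of_eventuallyEq (.of_forall fun r => ?_)
    · simp [polyGauss, gaussDeriv]
      ring
    · simp [polyGauss]
  · have h1 := (gaussDeriv Q).continuous
    simp only [Function.uncurry_def]
    fun_prop
  · intro s hs
    have hs0 : 0 < s := hp.trans_le hs.1
    have h : ∀ x, (x - p.x₀) * ((gaussDeriv Q).eval (s * (x - p.x₀))
        * Real.exp (-(s * (x - p.x₀)) ^ 2 / 2))
        = polyGauss ⟨p.N, s, p.x₀, hs0⟩ (C s⁻¹ * (X * gaussDeriv Q)) x := fun x => by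
      simp [polyGauss]
      field_simp
    simp only [h]
    rw [lintegral_polyGauss_sq, mul_pow, ← C_pow, ← smul_eq_C_mul, map_smul, smul_eq_mul]
    refine ENNReal.ofReal_le_ofReal (le_of_eq ?_)
    simp only
    field_simp
  · have hne : ∀ s ∈ Icc p.β q.β, s ^ 3 ≠ 0 := fun s hs => (pow_pos (hp.trans_le hs.1) 3).ne'
    have hcont : ContinuousOn (fun s => gaussI ((X * gaussDeriv Q) ^ 2) * (s ^ 3)⁻¹)
        (Icc p.β q.β) := continuousOn_const.mul ((continuousOn_id.pow 3).inv₀ hne)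
    rw [← ofReal_integral_eq_lintegral_ofReal hcont.integrableOn_Icc
      ((ae_restrict_iff' measurableSet_Icc).2 (ae_of_all _ fun s hs =>
        mul_nonneg hI (inv_nonneg.2 (pow_pos (hp.trans_le hs.1) 3).le)))]
    refine ENNReal.ofReal_le_ofReal (le_of_eq ?_)
    rw [integral_Icc_eq_integral_Ioc, ← intervalIntegral.integral_of_le hβ]
    rw [← uIcc_of_le hβ] at hcont
    rw [intervalIntegral.integral_eq_sub_of_hasDerivAt
      (f := fun s => gaussI ((X * gaussDeriv Q) ^ 2) * (-(s ^ 2)⁻¹ / 2)) ?_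
      hcont.intervalIntegrable]
    · field_simp
      ring
    · intro s hs
      rw [uIcc_of_le hβ] at hs
      have hs0 : 0 < s := hp.trans_le hs.1
      have := ((((hasDerivAt_pow 2 s).inv (pow_pos hs0 2).ne').fun_neg).div_const 2).const_mul
        (gaussI ((X * gaussDeriv Q) ^ 2))
      refine this.congr_deriv ?_
      push_cast
      field_simp

/-! ### Projection errors of the adaptive steps -/

lemma norm_sub_proj_le (p : Params) (g : L2) {W : H1} (hW : W ∈ P p) :
    ‖g - toL2 (proj p g)‖ ≤ ‖g - toL2 W‖ := by
  rw [toL2_proj, Submodule.starProjection_minimal]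
  have hb : BddBelow (range fun x : PL2 p => ‖g - x‖) :=
    ⟨0, by rintro _ ⟨_, rfl⟩; exact norm_nonneg _⟩
  exact ciInf_le hb ⟨toL2 W, Submodule.mem_map_of_mem hW⟩

lemma proj_mem (p : Params) (g : L2) : proj p g ∈ P p := by
  simp [proj]

/-- The Hermite spaces before and after a step share the polynomials, so the projection error of an
adaptive step is bounded by the effect of changing the parameters in the Hermite functions. -/
lemma norm_sub_proj_step_le {p : Params} {U : H1} (hU : U ∈ P p) (σ : Step) :
    ‖toL2 U - toL2 (proj (σ.apply p) (toL2 U))‖ ≤ σ.eS p U + σ.eM p U + σ.eC p U := by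
  obtain ⟨Q, hQ, rfl⟩ := mem_P_iff.1 hU
  have key : ∀ q : Params, Q ∈ hermSpan q.N →
      ‖toL2 (polyGaussH1 p Q) - toL2 (proj q (toL2 (polyGaussH1 p Q)))‖
        ≤ ‖toL2 (polyGaussH1 p Q) - toL2 (polyGaussH1 q Q)‖ := fun q hq =>
    norm_sub_proj_le q _ (mem_P_iff.2 ⟨Q, hq, rfl⟩)
  match σ with
  | .scale β' h =>
    simp only [Step.eS, Step.eM, Step.eC, Step.apply, add_zero]
    exact (key ⟨p.N, β', p.x₀, h⟩ hQ).trans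
      (norm_sub_scale_le (p := p) (q := ⟨p.N, β', p.x₀, h⟩) rfl Q)
  | .move x₀' =>
    simp only [Step.eS, Step.eM, Step.eC, Step.apply, add_zero, zero_add]
    exact (key ⟨p.N, p.β, x₀', p.β_pos⟩ hQ).trans
      (norm_sub_move_le (p := p) (q := ⟨p.N, p.β, x₀', p.β_pos⟩) rfl Q)
  | .order N' =>
    simp only [Step.eS, Step.eM, Step.eC, Step.apply, zero_add]
    split_ifs with hN
    · exact le_rfl
    · refine (key ⟨N', p.β, p.x₀, p.β_pos⟩ (hermSpan_mono (not_lt.1 hN) hQ)).trans (le_of_eq ?_)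
      exact norm_eq_zero.2 (sub_self (toL2 (polyGaussH1 p Q)))

lemma scaleFactor_nonneg {β β' : ℝ} (h' : 0 < β') : 0 ≤ scaleFactor β β' := by
  unfold scaleFactor; positivity

lemma Step.eS_nonneg (p : Params) (U : H1) (σ : Step) : 0 ≤ σ.eS p U := by
  match σ with
  | .scale β' h => exact mul_nonneg (scaleFactor_nonneg h) ENNReal.toReal_nonneg
  | .move _ => exact le_rfl
  | .order _ => exact le_rfl

lemma Step.eM_nonneg (p : Params) (U : H1) (σ : Step) : 0 ≤ σ.eM p U := by
  match σ with
  | .scale _ _ => exact le_rfl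
  | .move _ => exact mul_nonneg (abs_nonneg _) (norm_nonneg _)
  | .order _ => exact le_rfl

lemma Step.eC_nonneg (p : Params) (U : H1) (σ : Step) : 0 ≤ σ.eC p U := by
  match σ with
  | .scale _ _ => exact le_rfl
  | .move _ => exact le_rfl
  | .order _ =>
    simp only [Step.eC]
    split_ifs
    exacts [norm_nonneg _, le_rfl]

lemma Step.eS_le_eS' {p : Params} {U : H1} (hU : U ∈ P p) (σ : Step) : σ.eS p U ≤ σ.eS' p U := by
  match σ with
  | .scale β' h =>
    simp only [Step.eS, Step.eS', mul_assoc]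
    exact mul_le_mul_of_nonneg_left (normXDx_le hU) (scaleFactor_nonneg h)
  | .move _ => exact le_rfl
  | .order _ => exact le_rfl

lemma Step.eM_le_eM' {p : Params} {U : H1} (hU : U ∈ P p) (σ : Step) : σ.eM p U ≤ σ.eM' p U := by
  match σ with
  | .scale _ _ => exact le_rfl
  | .move x₀' =>
    simp only [Step.eM, Step.eM']
    calc |p.x₀ - x₀'| * ‖dx U‖ ≤ |p.x₀ - x₀'| * (√(2 * p.N + 1) * p.β * ‖toL2 U‖) :=
          mul_le_mul_of_nonneg_left (norm_dx_le hU) (abs_nonneg _)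
      _ = _ := by ring
  | .order _ => exact le_rfl

end Hermite

/-! ### The spaces `X(s,t)` -/

lemma norm_toL2_le (g : H1) : ‖toL2 g‖ ≤ ‖g‖ := by
  refine le_of_sq_le_sq ?_ (norm_nonneg _)
  have h : ‖g‖ ^ 2 = ‖toL2 g‖ ^ 2 + ‖dx g‖ ^ 2 := WithLp.prod_norm_sq_eq_of_L2 g.1
  rw [h]
  exact le_add_of_nonneg_right (sq_nonneg _)

/-- The inclusion `H¹(ℝ) → L²(ℝ)` as a bounded operator. -/
def toL2L : H1 →L[ℝ] L2 := toL2.mkContinuous 1 fun g => by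
  rw [one_mul]
  exact norm_toL2_le g

lemma continuous_toL2 : Continuous toL2 := toL2L.continuous

lemma continuous_proj (p : Params) : Continuous (proj p) :=
  (LinearMap.continuous_of_finiteDimensional ((P p).subtype ∘ₗ
    ((P p).equivMapOfInjective toL2 toL2_injective).symm.toLinearMap)).comp
    ((PL2 p).orthogonalProjectionOnto).continuous

/-- The `L²`-projection onto the Hermite space as a bounded operator on `H¹(ℝ)`. -/
def projH1 (p : Params) : H1 →L[ℝ] H1 :=
  ⟨proj p ∘ₗ toL2, (continuous_proj p).comp continuous_toL2⟩

lemma projH1_apply (p : Params) (g : H1) : projH1 p g = proj p (toL2 g) := rfl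

lemma projH1_mem (p : Params) (g : H1) : projH1 p g ∈ P p := proj_mem p _

lemma projH1_of_mem {p : Params} {g : H1} (hg : g ∈ P p) : projH1 p g = g := by
  refine toL2_injective ?_
  rw [projH1_apply, toL2_proj]
  exact Submodule.starProjection_eq_self_iff.2 (Submodule.mem_map_of_mem hg)

namespace MemX

variable {s t : ℝ} {u w : ℝ → H1}

lemma mono (h : MemX s t u) {s' t' : ℝ} (hs : s ≤ s') (ht : t' ≤ t) (hst : s' ≤ t') :
    MemX s' t' u := by
  have hsub : Icc s' t' ⊆ Icc s t := Icc_subset_Icc hs ht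
  have hint : ∀ a ∈ Icc s t, ∀ b ∈ Icc s t, IntervalIntegrable (deriv u) volume a b :=
    fun a ha b hb => IntegrableOn.intervalIntegrable (IntegrableOn.mono_set
      (h.memLp_deriv.integrable (by norm_num)) (uIcc_subset_Icc ha hb))
  refine ⟨h.memLp.mono_measure (Measure.restrict_mono hsub le_rfl),
    h.memLp_deriv.mono_measure (Measure.restrict_mono hsub le_rfl), fun r hr => ?_⟩
  have hs' : s' ∈ Icc s t := hsub ⟨le_rfl, hst⟩
  have hs0 : s ∈ Icc s t := ⟨le_rfl, hs'.1.trans hs'.2⟩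
  rw [h.eq_add_integral r (hsub hr), h.eq_add_integral s' hs', add_assoc,
    intervalIntegral.integral_add_adjacent_intervals (hint _ hs0 _ hs') (hint _ hs' _ (hsub hr))]

lemma intervalIntegrable_deriv (h : MemX s t u) (hst : s ≤ t) :
    IntervalIntegrable (deriv u) volume s t := by
  refine IntegrableOn.intervalIntegrable ?_
  rw [uIcc_of_le hst]
  exact h.memLp_deriv.integrable (by norm_num)

lemma ae_hasDerivAt (h : MemX s t u) (hst : s ≤ t) :
    ∀ᵐ r ∂volume.restrict (Icc s t), HasDerivAt u (deriv u r) r := by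
  rw [← Measure.restrict_congr_set Ioo_ae_eq_Icc, ae_restrict_iff' measurableSet_Ioo]
  filter_upwards [(h.intervalIntegrable_deriv hst).ae_hasDerivAt_integral] with r hr hr'
  rw [uIcc_of_le hst] at hr
  have h1 := (hr (Ioo_subset_Icc_self hr') s ⟨le_rfl, hst⟩).const_add (u s)
  refine h1.congr_of_eventuallyEq ?_
  filter_upwards [Ioo_mem_nhds hr'.1 hr'.2] with x hx
  exact h.eq_add_integral x (Ioo_subset_Icc_self hx)

/-- A function which is a primitive of a square integrable function lies in `X(s,t)`. -/
lemma of_ae_hasDerivAt {g : ℝ → H1} (hu : MemLp u 2 (volume.restrict (Icc s t)))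
    (hg : MemLp g 2 (volume.restrict (Icc s t)))
    (hd : ∀ᵐ r ∂volume.restrict (Icc s t), HasDerivAt u (g r) r)
    (h : ∀ r ∈ Icc s t, u r = u s + ∫ τ in s..r, g τ) : MemX s t u := by
  have hae : deriv u =ᵐ[volume.restrict (Icc s t)] g := hd.mono fun r hr => hr.deriv
  refine ⟨hu, hg.ae_eq hae.symm, fun r hr => ?_⟩
  rw [h r hr]
  congr 1
  refine intervalIntegral.integral_congr_ae_restrict ?_
  rw [uIoc_of_le hr.1]
  exact ae_restrict_of_ae_restrict_of_subset
    (Ioc_subset_Icc_self.trans (Icc_subset_Icc le_rfl hr.2)) hae.symm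

lemma clm_comp (h : MemX s t u) (hst : s ≤ t) (L : H1 →L[ℝ] H1) :
    MemX s t fun r => L (u r) := by
  refine of_ae_hasDerivAt (g := fun r => L (deriv u r)) (L.comp_memLp' h.memLp)
    (L.comp_memLp' h.memLp_deriv) ?_ fun r hr => ?_
  · filter_upwards [h.ae_hasDerivAt hst] with r hr
    exact L.hasFDerivAt.comp_hasDerivAt r hr
  · have := (h.mono le_rfl hr.2 hr.1).intervalIntegrable_deriv hr.1
    rw [L.intervalIntegral_comp_comm this, ← map_add, ← h.eq_add_integral r hr]

lemma sub (h : MemX s t u) (hw : MemX s t w) (hst : s ≤ t) : MemX s t fun r => u r - w r := by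
  refine of_ae_hasDerivAt (g := fun r => deriv u r - deriv w r) (h.memLp.sub hw.memLp)
    (h.memLp_deriv.sub hw.memLp_deriv) ?_ fun r hr => ?_
  · filter_upwards [h.ae_hasDerivAt hst, hw.ae_hasDerivAt hst] with r hr hr'
    exact hr.sub hr'
  · rw [intervalIntegral.integral_sub ((h.mono le_rfl hr.2 hr.1).intervalIntegrable_deriv hr.1)
      ((hw.mono le_rfl hr.2 hr.1).intervalIntegrable_deriv hr.1), h.eq_add_integral r hr,
      hw.eq_add_integral r hr]
    abel

lemma continuousOn (h : MemX s t u) (hst : s ≤ t) : ContinuousOn u (Icc s t) := by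
  have h2 := intervalIntegral.continuousOn_primitive_interval (μ := volume) (a := s) (b := t)
    (f := deriv u) (by rw [uIcc_of_le hst]; exact h.memLp_deriv.integrable (by norm_num))
  rw [uIcc_of_le hst] at h2
  exact (continuousOn_const.add h2).congr h.eq_add_integral

/-- The energy identity `‖u(t)‖² - ‖u(s)‖² = 2 ∫ₛᵗ (∂ᵣu, u) dr`: the function `‖u(·)‖²` is
absolutely continuous. -/
lemma norm_sq_sub (h : MemX s t u) (hst : s ≤ t) :
    ‖toL2 (u t)‖ ^ 2 - ‖toL2 (u s)‖ ^ 2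
      = 2 * ∫ r in s..t, inner ℝ (toL2 (deriv u r)) (toL2 (u r)) := by
  obtain ⟨M, hM⟩ := isCompact_Icc.exists_bound_of_continuousOn (h.continuousOn hst)
  have hi := h.intervalIntegrable_deriv hst
  have hac : AbsolutelyContinuousOnInterval (fun r => ‖toL2 (u r)‖ ^ 2) s t := by
    have hG := (hi.norm.absolutelyContinuousOnInterval_intervalIntegral
      (c := s) left_mem_uIcc).const_mul (2 * M)
    unfold AbsolutelyContinuousOnInterval at hG ⊢
    refine squeeze_zero' (.of_forall fun _ => Finset.sum_nonneg fun _ _ => dist_nonneg) ?_ hG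
    rw [Filter.eventually_inf_principal]
    refine .of_forall fun E hE => Finset.sum_le_sum fun i hi' => ?_
    obtain ⟨hx, hy⟩ := hE.1 i hi'
    set x := (E.2 i).1
    set y := (E.2 i).2
    rw [uIcc_of_le hst] at hx hy
    have h0 : s ∈ Icc s t := ⟨le_rfl, hst⟩
    have hsub : ∀ z ∈ Icc s t, IntervalIntegrable (deriv u) volume s z := fun z hz =>
      hi.mono_set (by rw [uIcc_of_le hst, uIcc_of_le hz.1]; exact Icc_subset_Icc le_rfl hz.2)
    have hdist : ‖u x - u y‖
        ≤ |(∫ τ in s..x, ‖deriv u τ‖) - ∫ τ in s..y, ‖deriv u τ‖| := by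
      rw [h.eq_add_integral x hx, h.eq_add_integral y hy, add_sub_add_left_eq_sub,
        intervalIntegral.integral_interval_sub_left (hsub x hx) (hsub y hy),
        intervalIntegral.integral_interval_sub_left (hsub x hx).norm (hsub y hy).norm]
      exact intervalIntegral.norm_integral_le_abs_integral_norm
    have hM0 : 0 ≤ M := (norm_nonneg _).trans (hM s h0)
    have h3 : |‖toL2 (u x)‖ - ‖toL2 (u y)‖| ≤ ‖u x - u y‖ := by
      refine (abs_norm_sub_norm_le _ _).trans ?_
      rw [← map_sub]
      exact norm_toL2_le _
    have h4 : |‖toL2 (u x)‖ + ‖toL2 (u y)‖| ≤ 2 * M := by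
      rw [abs_of_nonneg (by positivity)]
      linarith [(norm_toL2_le (u x)).trans (hM x hx), (norm_toL2_le (u y)).trans (hM y hy)]
    rw [Real.dist_eq, Real.dist_eq, ← mul_sub, abs_mul, abs_of_nonneg (by positivity : 0 ≤ 2 * M),
      sq_sub_sq, abs_mul]
    exact mul_le_mul h4 (h3.trans hdist) (abs_nonneg _) (by positivity)
  rw [← hac.integral_deriv_eq_sub, ← intervalIntegral.integral_const_mul]
  refine intervalIntegral.integral_congr_ae_restrict ?_
  rw [uIoc_of_le hst]
  filter_upwards [ae_restrict_of_ae_restrict_of_subset Ioc_subset_Icc_self (h.ae_hasDerivAt hst)]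
    with r hr
  have h1 : HasDerivAt (fun r => toL2 (u r)) (toL2 (deriv u r)) r :=
    toL2L.hasFDerivAt.comp_hasDerivAt r hr
  rw [h1.norm_sq.deriv, real_inner_comm]

end MemX

lemma ae_restrict_Ioc_of_Icc {s t : ℝ} {q : ℝ → Prop}
    (h : ∀ᵐ r ∂volume.restrict (Icc s t), q r) : ∀ᵐ r ∂volume.restrict (Ioc s t), q r :=
  ae_restrict_of_ae_restrict_of_subset Ioc_subset_Icc_self h

lemma intervalIntegrable_of_integrable_Icc {s t : ℝ} (hst : s ≤ t) {g : ℝ → ℝ}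
    (h : Integrable g (volume.restrict (Icc s t))) : IntervalIntegrable g volume s t := by
  refine IntegrableOn.intervalIntegrable ?_
  rw [uIcc_of_le hst]
  exact h

lemma integrable_inner_toL2 {μ : Measure ℝ} {u v : ℝ → H1} (hu : MemLp u 2 μ) (hv : MemLp v 2 μ) :
    Integrable (fun r => inner ℝ (toL2 (u r)) (toL2 (v r))) μ := by
  refine (hu.norm.integrable_mul hv.norm).mono'
    ((continuous_toL2.comp_aestronglyMeasurable hu.1).inner
      (continuous_toL2.comp_aestronglyMeasurable hv.1)) (ae_of_all _ fun r => ?_)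
  exact (norm_inner_le_norm _ _).trans
    (mul_le_mul (norm_toL2_le _) (norm_toL2_le _) (norm_nonneg _) (norm_nonneg _))

/-- The trace estimate `‖u(t)‖ ≤ ‖u‖_{X(s,t)}`. -/
lemma MemX.norm_toL2_le_normX {s t : ℝ} {u : ℝ → H1} (h : MemX s t u) (hst : s ≤ t) :
    ‖toL2 (u t)‖ ≤ normX s t u := by
  refine Real.le_sqrt_of_sq_le ?_
  rw [← sub_le_iff_le_add, h.norm_sq_sub hst, ← intervalIntegral.integral_const_mul,
    intervalIntegral.integral_of_le hst, intervalIntegral.integral_of_le hst]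
  have hi : IntegrableOn (fun r => ‖u r‖ ^ 2 + ‖deriv u r‖ ^ 2) (Icc s t) :=
    (h.memLp.integrable_norm_pow (by norm_num)).add
      (h.memLp_deriv.integrable_norm_pow (by norm_num))
  have hi' := hi.mono_set Ioc_subset_Icc_self
  have hle : ∀ r, 2 * inner ℝ (toL2 (deriv u r)) (toL2 (u r)) ≤ ‖u r‖ ^ 2 + ‖deriv u r‖ ^ 2 := by
    intro r
    have h1 := real_inner_le_norm (toL2 (deriv u r)) (toL2 (u r))
    have h2 := mul_le_mul (norm_toL2_le (deriv u r)) (norm_toL2_le (u r)) (norm_nonneg _)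
      (norm_nonneg _)
    nlinarith [sq_nonneg (‖u r‖ - ‖deriv u r‖)]
  have hint := IntegrableOn.mono_set ((integrable_inner_toL2 h.memLp_deriv h.memLp).const_mul 2)
    (Ioc_subset_Icc_self (a := s) (b := t))
  exact integral_mono hint hi' hle

/-! ### Integrability in time and the bilinear form `B` -/

/-- Measurability in time of `b r v` for every fixed `v` passes to time-dependent arguments, by
approximation with simple functions. -/
lemma aestronglyMeasurable_linear_apply {μ : Measure ℝ} {b : ℝ → H1 →ₗ[ℝ] ℝ}
    (hb : ∀ v, AEStronglyMeasurable (fun r => b r v) μ) (hc : ∀ᵐ r ∂μ, Continuous (b r))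
    {u : ℝ → H1} (hu : AEStronglyMeasurable u μ) :
    AEStronglyMeasurable (fun r => b r (u r)) μ := by
  have hsimple : ∀ g : SimpleFunc ℝ H1, AEStronglyMeasurable (fun r => b r (g r)) μ := by
    intro g
    have h : (fun r => b r (g r))
        = ∑ v ∈ g.range, (g ⁻¹' {v}).indicator fun r => b r v := by
      funext r
      rw [Finset.sum_apply, Finset.sum_eq_single (g r)]
      · simp
      · intro v _ hv
        exact indicator_of_notMem (fun h => hv h.symm) _
      · exact fun h => (h (g.mem_range_self r)).elim
    rw [h]
    exact Finset.aestronglyMeasurable_sum _ fun v _ =>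
      (hb v).indicator (g.measurableSet_fiber v)
  obtain ⟨g, hg, hug⟩ := hu
  refine AEStronglyMeasurable.congr (f := fun r => b r (g r)) ?_ ?_
  · refine aestronglyMeasurable_of_tendsto_ae Filter.atTop (fun n => hsimple (hg.approx n)) ?_
    filter_upwards [hc] with r hr
    exact (hr.tendsto _).comp (hg.tendsto_approx r)
  · filter_upwards [hug] with r hr
    rw [hr]

section Form

variable {T c₀ C₀ s t : ℝ} {a : ℝ → H1 →ₗ[ℝ] H1 →ₗ[ℝ] ℝ} {u w v : ℝ → H1}

lemma IsParabolicForm.integrable (ha : IsParabolicForm T c₀ C₀ a) (hs : 0 ≤ s) (ht : t ≤ T)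
    (hu : MemLp u 2 (volume.restrict (Icc s t))) (hv : MemLp v 2 (volume.restrict (Icc s t))) :
    Integrable (fun r => a r (u r) (v r)) (volume.restrict (Icc s t)) := by
  have hsub : Icc s t ⊆ Icc 0 T := Icc_subset_Icc hs ht
  have hmem : ∀ᵐ r ∂volume.restrict (Icc s t), r ∈ Icc 0 T :=
    (ae_restrict_mem measurableSet_Icc).mono fun r hr => hsub hr
  have hmeas : ∀ v w, AEStronglyMeasurable (fun r => a r v w) (volume.restrict (Icc s t)) :=
    fun v w => (ha.aestronglyMeasurable v w).mono_measure (Measure.restrict_mono hsub le_rfl)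
  have hc : ∀ r ∈ Icc 0 T, ∀ w, Continuous (a r w) := fun r hr w =>
    AddMonoidHomClass.continuous_of_bound (a r w) (C₀ * ‖w‖) fun v => ha.bounded r hr w v
  have h1 : ∀ v : H1, AEStronglyMeasurable (fun r => a r (u r) v) (volume.restrict (Icc s t)) := by
    intro v
    have := aestronglyMeasurable_linear_apply (b := fun r => (a r).flip v) (fun w => hmeas w v)
      (hmem.mono fun r hr => AddMonoidHomClass.continuous_of_bound ((a r).flip v) (C₀ * ‖v‖)
        fun w => by
          rw [LinearMap.flip_apply, Real.norm_eq_abs, mul_right_comm]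
          exact ha.bounded r hr w v) hu.1
    exact this
  have h2 := aestronglyMeasurable_linear_apply (b := fun r => a r (u r)) h1
    (hmem.mono fun r hr => hc r hr (u r)) hv.1
  refine ((hu.norm.integrable_mul hv.norm).const_mul C₀).mono' h2 ?_
  filter_upwards [hmem] with r hr
  rw [Pi.mul_apply, ← mul_assoc]
  exact ha.bounded r hr _ _

lemma B_sub (ha : IsParabolicForm T c₀ C₀ a) (hs : 0 ≤ s) (hst : s ≤ t) (ht : t ≤ T)
    (hu : MemX s t u) (hw : MemX s t w) (hv : MemLp v 2 (volume.restrict (Icc s t))) (v' : H1) :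
    B a s t (fun r => u r - w r) v v' = B a s t u v v' - B a s t w v v' := by
  have hi : ∀ {z : ℝ → H1}, MemX s t z → IntervalIntegrable (fun r =>
      inner ℝ (toL2 (deriv z r)) (toL2 (v r)) + a r (z r) (v r)) volume s t := fun hz =>
    intervalIntegrable_of_integrable_Icc hst
      ((integrable_inner_toL2 hz.memLp_deriv hv).add (ha.integrable hs ht hz.memLp hv))
  have h : ∫ r in s..t, (inner ℝ (toL2 (deriv (fun r => u r - w r) r)) (toL2 (v r))
      + a r (u r - w r) (v r))
      = (∫ r in s..t, (inner ℝ (toL2 (deriv u r)) (toL2 (v r)) + a r (u r) (v r)))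
      - ∫ r in s..t, (inner ℝ (toL2 (deriv w r)) (toL2 (v r)) + a r (w r) (v r)) := by
    rw [← intervalIntegral.integral_sub (hi hu) (hi hw)]
    refine intervalIntegral.integral_congr_ae_restrict ?_
    rw [uIoc_of_le hst]
    filter_upwards [ae_restrict_Ioc_of_Icc (hu.ae_hasDerivAt hst),
      ae_restrict_Ioc_of_Icc (hw.ae_hasDerivAt hst)] with r h1 h2
    rw [(h1.fun_sub h2).deriv]
    simp only [map_sub, inner_sub_left, LinearMap.sub_apply]
    ring
  rw [B, B, B, h, map_sub, inner_sub_left]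
  ring

end Form

/-! ### Continuity constants -/

lemma integral_mul_le_sqrt_mul_sqrt {μ : Measure ℝ} {f g : ℝ → ℝ} (hf : MemLp f 2 μ)
    (hg : MemLp g 2 μ) : ∫ x, f x * g x ∂μ ≤ √(∫ x, f x ^ 2 ∂μ) * √(∫ x, g x ^ 2 ∂μ) := by
  have h := real_inner_le_norm (hf.toLp f) (hg.toLp g)
  rw [L2.inner_def] at h
  rw [← norm_sq_toLp hf, ← norm_sq_toLp hg, Real.sqrt_sq (norm_nonneg _),
    Real.sqrt_sq (norm_nonneg _)]
  refine le_of_eq_of_le (integral_congr_ae ?_) h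
  filter_upwards [hf.coeFn_toLp, hg.coeFn_toLp] with x hx hx'
  rw [hx, hx']
  simp [mul_comm]

section Form

variable {T c₀ C₀ s t : ℝ} {a : ℝ → H1 →ₗ[ℝ] H1 →ₗ[ℝ] ℝ} {u v : ℝ → H1}

theorem IsParabolicForm.isContinuityConst (ha : IsParabolicForm T c₀ C₀ a) :
    IsContinuityConst T a (|C₀| + 2) := by
  intro s t hs hst ht p u v v' hu hv _
  have hv1 := hv.1
  set m := volume.restrict (Icc s t) with hm
  have hu2 : Integrable (fun r => ‖u r‖ ^ 2) m := hu.memLp.integrable_norm_pow (by norm_num)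
  have hd2 : Integrable (fun r => ‖deriv u r‖ ^ 2) m :=
    hu.memLp_deriv.integrable_norm_pow (by norm_num)
  have hX : normX s t u = √((∫ r, ‖u r‖ ^ 2 ∂m) + (∫ r, ‖deriv u r‖ ^ 2 ∂m)
      + ‖toL2 (u s)‖ ^ 2) := by
    rw [normX, intervalIntegral.integral_of_le hst, ← integral_Icc_eq_integral_Ioc,
      ← integral_add hu2 hd2]
  have hY : normY s t v v' = √((∫ r, ‖v r‖ ^ 2 ∂m) + ‖toL2 v'‖ ^ 2) := by
    rw [normY, intervalIntegral.integral_of_le hst, ← integral_Icc_eq_integral_Ioc]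
  have hI1 : 0 ≤ ∫ r, ‖u r‖ ^ 2 ∂m := integral_nonneg fun r => sq_nonneg _
  have hI2 : 0 ≤ ∫ r, ‖deriv u r‖ ^ 2 ∂m := integral_nonneg fun r => sq_nonneg _
  have hI3 : 0 ≤ ∫ r, ‖v r‖ ^ 2 ∂m := integral_nonneg fun r => sq_nonneg _
  have hXd : √(∫ r, ‖deriv u r‖ ^ 2 ∂m) ≤ normX s t u := by
    rw [hX]; exact Real.sqrt_le_sqrt (by linarith [sq_nonneg ‖toL2 (u s)‖])
  have hXu : √(∫ r, ‖u r‖ ^ 2 ∂m) ≤ normX s t u := by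
    rw [hX]; exact Real.sqrt_le_sqrt (by linarith [sq_nonneg ‖toL2 (u s)‖])
  have hXs : ‖toL2 (u s)‖ ≤ normX s t u := by
    rw [hX]; exact Real.le_sqrt_of_sq_le (by linarith)
  have hYv : √(∫ r, ‖v r‖ ^ 2 ∂m) ≤ normY s t v v' := by
    rw [hY]; exact Real.sqrt_le_sqrt (by linarith [sq_nonneg ‖toL2 v'‖])
  have hYs : ‖toL2 v'‖ ≤ normY s t v v' := by
    rw [hY]; exact Real.le_sqrt_of_sq_le (by linarith)
  have hX0 : 0 ≤ normX s t u := Real.sqrt_nonneg _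
  have h1 : ∫ r, ‖deriv u r‖ * ‖v r‖ ∂m ≤ normX s t u * normY s t v v' :=
    (integral_mul_le_sqrt_mul_sqrt hu.memLp_deriv.norm hv1.norm).trans
      (mul_le_mul hXd hYv (Real.sqrt_nonneg _) hX0)
  have h2 : ∫ r, ‖u r‖ * ‖v r‖ ∂m ≤ normX s t u * normY s t v v' :=
    (integral_mul_le_sqrt_mul_sqrt hu.memLp.norm hv1.norm).trans
      (mul_le_mul hXu hYv (Real.sqrt_nonneg _) hX0)
  have h3 : inner ℝ (toL2 (u s)) (toL2 v') ≤ normX s t u * normY s t v v' :=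
    (real_inner_le_norm _ _).trans (mul_le_mul hXs hYs (norm_nonneg _) hX0)
  have i1 : Integrable (fun r => ‖deriv u r‖ * ‖v r‖) m :=
    hu.memLp_deriv.norm.integrable_mul hv1.norm
  have i2 : Integrable (fun r => ‖u r‖ * ‖v r‖) m := hu.memLp.norm.integrable_mul hv1.norm
  have h4 : ∫ r in s..t, (inner ℝ (toL2 (deriv u r)) (toL2 (v r)) + a r (u r) (v r))
      ≤ (∫ r, ‖deriv u r‖ * ‖v r‖ ∂m) + |C₀| * ∫ r, ‖u r‖ * ‖v r‖ ∂m := by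
    rw [intervalIntegral.integral_of_le hst, ← integral_Icc_eq_integral_Ioc,
      ← integral_const_mul, ← integral_add i1 (i2.const_mul _)]
    refine integral_mono_ae ((integrable_inner_toL2 hu.memLp_deriv hv1).add
      (ha.integrable hs ht hu.memLp hv1)) (i1.add (i2.const_mul _)) ?_
    filter_upwards [ae_restrict_mem measurableSet_Icc] with r hr
    have hb := (le_abs_self _).trans (ha.bounded r ⟨hs.trans hr.1, hr.2.trans ht⟩ (u r) (v r))
    have hn := (real_inner_le_norm (toL2 (deriv u r)) (toL2 (v r))).trans
      (mul_le_mul (norm_toL2_le _) (norm_toL2_le _) (norm_nonneg _) (norm_nonneg _))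
    have hC := mul_le_mul_of_nonneg_right (le_abs_self C₀)
      (mul_nonneg (norm_nonneg (u r)) (norm_nonneg (v r)))
    linarith
  have h5 := mul_le_mul_of_nonneg_left h2 (abs_nonneg C₀)
  rw [B]
  linarith

/-- There are nonzero functions in every Hermite space. -/
lemma exists_mem_P_norm_pos (p : Params) : ∃ g ∈ P p, 0 < ‖toL2 g‖ := by
  refine ⟨polyGaussH1 p 1, mem_P_iff.2 ⟨1, Submodule.subset_span ⟨0, rfl⟩, rfl⟩, ?_⟩
  have h := norm_sq_toL2_polyGaussH1 p 1
  rw [one_pow] at h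
  have := mul_pos (inv_pos.2 p.β_pos) gaussI_one_pos
  rw [← h] at this
  exact pos_of_mul_pos_left (by rwa [pow_two] at this) (norm_nonneg _)

/-- A continuity constant is nonnegative: on an interval of length zero, `B(g, (0, g)) = ‖g‖²`. -/
lemma IsContinuityConst.nonneg {B₀ : ℝ} (hT : 0 ≤ T) (hB : IsContinuityConst T a B₀) :
    0 ≤ B₀ := by
  obtain ⟨g, hg, hpos⟩ := exists_mem_P_norm_pos ⟨0, 1, 0, one_pos⟩
  have h := hB 0 0 le_rfl le_rfl hT ⟨0, 1, 0, one_pos⟩ (fun _ => g) 0 g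
    ⟨memLp_const g, by rw [deriv_const']; exact memLp_const 0, fun r hr => by simp⟩
    ⟨memLp_const 0, fun _ => Submodule.zero_mem _⟩ hg
  simp only [B, normX, normY, intervalIntegral.integral_same, zero_add,
    Real.sqrt_sq (norm_nonneg _), real_inner_self_eq_norm_mul_norm, mul_assoc] at h
  have := mul_pos hpos hpos
  by_contra! hlt
  nlinarith

lemma bConst_pos (hc : 0 < c₀) (hC : c₀ ≤ C₀) (p : Params) : 0 < bConst c₀ C₀ p := by
  have h1 : (0 : ℝ) < 2 * p.N * p.β ^ 2 + 1 := by
    have := p.β_pos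
    positivity
  have h2 : 0 < C₀ + 1 := by linarith
  unfold bConst
  refine lt_min (by norm_num) (lt_min (by positivity) (by positivity))

lemma IsParabolicForm.le_bound (ha : IsParabolicForm T c₀ C₀ a) (hT : 0 ≤ T) : c₀ ≤ C₀ := by
  obtain ⟨g, -, hpos⟩ := exists_mem_P_norm_pos ⟨0, 1, 0, one_pos⟩
  have h0 : (0 : ℝ) ∈ Icc 0 T := ⟨le_rfl, hT⟩
  have h1 := ha.coercive 0 h0 g
  have h2 := (le_abs_self _).trans (ha.bounded 0 h0 g g)
  have h3 : 0 < ‖g‖ := hpos.trans_le (norm_toL2_le g)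
  rw [mul_assoc, ← pow_two] at h2
  exact le_of_mul_le_mul_right (h1.trans h2) (pow_pos h3 2)

/-! ### Error of one Galerkin step -/

/-- The exceptional null set in the weak equation can be chosen for all test functions in a Hermite
space simultaneously. -/
lemma IsSolution.ae_forall_mem_P {f : ℝ → L2} {u₀ : L2} (h : IsSolution T a f u₀ u) (p : Params) :
    ∀ᵐ r ∂volume.restrict (Icc 0 T), ∀ v ∈ P p,
      inner ℝ (toL2 (deriv u r)) (toL2 v) + a r (u r) v = inner ℝ (f r) (toL2 v) := by
  filter_upwards [ae_all_iff.2 fun i : Fin (p.N + 1) => h.weak_eq (hermiteH1 p i)] with r hr v hv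
  induction hv using Submodule.span_induction with
  | mem x hx =>
    obtain ⟨i, rfl⟩ := hx
    exact hr i
  | zero => simp
  | add x y _ _ hx hy =>
    simp only [map_add, inner_add_right, ← hx, ← hy]
    ring
  | smul c x _ hx =>
    simp only [map_smul, inner_smul_right, ← hx, smul_eq_mul]
    ring

lemma IsSolution.B_eq {f : ℝ → L2} {u₀ : L2} (h : IsSolution T a f u₀ u) (hs : 0 ≤ s)
    (hst : s ≤ t) (ht : t ≤ T) {p : Params} (hv : ∀ r, v r ∈ P p) (v' : H1) :
    B a s t u v v' = (∫ r in s..t, inner ℝ (f r) (toL2 (v r)))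
      + inner ℝ (toL2 (u s)) (toL2 v') := by
  rw [B]
  congr 1
  refine intervalIntegral.integral_congr_ae_restrict ?_
  rw [uIoc_of_le hst]
  filter_upwards [ae_restrict_of_ae_restrict_of_subset
    (Ioc_subset_Icc_self.trans (Icc_subset_Icc hs ht)) (h.ae_forall_mem_P p)] with r hr
  exact hr _ (hv r)

/-- The Galerkin solution starts from the projection of the datum. -/
lemma IsGalerkin.apply_left {f : ℝ → L2} {p : Params} {g : H1} {U : ℝ → H1}
    (h : IsGalerkin a f p s t g U) (hst : s ≤ t) : U s = proj p (toL2 g) := by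
  refine toL2_injective ?_
  rw [toL2_proj]
  refine (Submodule.eq_starProjection_of_mem_of_inner_eq_zero
    (Submodule.mem_map_of_mem (h.mem s ⟨le_rfl, hst⟩)) ?_).symm
  rintro _ ⟨v', hv', rfl⟩
  have h1 := h.eq (fun _ => 0) v' ⟨memLp_const 0, fun _ => Submodule.zero_mem _⟩ hv'
  simp only [B, map_zero, inner_zero_right, add_zero, intervalIntegral.integral_zero,
    zero_add] at h1
  rw [inner_sub_left, ← h1, sub_self]

lemma norm_toL2_proj_le (p : Params) (g : L2) : ‖toL2 (proj p g)‖ ≤ ‖g‖ := by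
  rw [toL2_proj]
  exact Submodule.norm_starProjection_apply_le _ _

/-- Energy estimate for `θ = U - π u`: testing the error equation with `θ` itself gives
`½ ‖θ(t)‖² + c₀ ∫ ‖θ‖² ≤ ½ ‖θ(s)‖² + B₀ ‖u - π u‖_X (∫ ‖θ‖²)^{1/2}`. -/
lemma norm_galerkin_sub_proj_le (ha : IsParabolicForm T c₀ C₀ a) {B₀ : ℝ}
    (hB : IsContinuityConst T a B₀) {f : ℝ → L2} {u₀ : L2}
    (hu : IsSolution T a f u₀ u) (hs : 0 ≤ s) (hst : s ≤ t) (ht : t ≤ T) {p : Params} {g : H1}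
    {U : ℝ → H1} (hU : IsGalerkin a f p s t g U) :
    ‖toL2 (U t) - toL2 (proj p (toL2 (u t)))‖ ^ 2
      ≤ ‖toL2 (proj p (toL2 g - toL2 (u s)))‖ ^ 2
        + (B₀ * normX s t fun r => u r - proj p (toL2 (u r))) ^ 2 / (2 * c₀) := by
  have hc := ha.c₀_pos
  have hus : MemX s t u := hu.memX.mono hs ht hst
  have hπ : MemX s t fun r => projH1 p (u r) := hus.clm_comp hst (projH1 p)
  have hθ : MemX s t fun r => U r - projH1 p (u r) := hU.memX.sub hπ hst
  have hη : MemX s t fun r => u r - projH1 p (u r) := hus.sub hπ hst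
  set θ : ℝ → H1 := fun r => U r - projH1 p (u r) with hθdef
  set X := normX s t fun r => u r - proj p (toL2 (u r)) with hXdef
  -- the test function equals `θ` on `[s, t]` and takes values in the Hermite space everywhere
  set v : ℝ → H1 := fun r => projH1 p (U r - u r) with hvdef
  have hvθ : ∀ r ∈ Icc s t, v r = θ r := fun r hr => by
    rw [hvdef, hθdef]
    simp only [map_sub, projH1_of_mem (hU.mem r hr)]
  have hv : MemL2P p s t v :=
    ⟨((hU.memX.sub hus hst).clm_comp hst (projH1 p)).memLp, fun r => projH1_mem p _⟩
  have hBθ : B a s t θ v 0 ≤ B₀ * X * normY s t v 0 := by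
    have h1 := B_sub ha hs hst ht hU.memX hπ hv.1 0
    have h2 := B_sub ha hs hst ht hus hπ hv.1 0
    have h3 := hU.eq v 0 hv (Submodule.zero_mem _)
    have h4 := hu.B_eq hs hst ht hv.2 0
    simp only [map_zero, inner_zero_right, add_zero] at h3 h4
    rw [h1, h3, ← h4, ← h2]
    exact hB s t hs hst ht p _ v 0 hη hv (Submodule.zero_mem _)
  have hY : normY s t v 0 = √(∫ r in s..t, ‖θ r‖ ^ 2) := by
    rw [normY, map_zero, norm_zero, zero_pow two_ne_zero, add_zero]
    congr 1
    refine intervalIntegral.integral_congr fun r hr => ?_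
    rw [uIcc_of_le hst] at hr
    simp only [hvθ r hr]
  have i1 : IntervalIntegrable (fun r => inner ℝ (toL2 (deriv θ r)) (toL2 (θ r))) volume s t :=
    intervalIntegrable_of_integrable_Icc hst (integrable_inner_toL2 hθ.memLp_deriv hθ.memLp)
  have i2 : IntervalIntegrable (fun r => a r (θ r) (θ r)) volume s t :=
    intervalIntegrable_of_integrable_Icc hst (ha.integrable hs ht hθ.memLp hθ.memLp)
  have i3 : IntervalIntegrable (fun r => c₀ * ‖θ r‖ ^ 2) volume s t :=
    intervalIntegrable_of_integrable_Icc hst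
      ((hθ.memLp.integrable_norm_pow (by norm_num)).const_mul c₀)
  have hlow : (‖toL2 (θ t)‖ ^ 2 - ‖toL2 (θ s)‖ ^ 2) / 2 + c₀ * ∫ r in s..t, ‖θ r‖ ^ 2
      ≤ B a s t θ v 0 := by
    have h1 : B a s t θ v 0 = (∫ r in s..t, inner ℝ (toL2 (deriv θ r)) (toL2 (θ r)))
        + ∫ r in s..t, a r (θ r) (θ r) := by
      rw [B, map_zero, inner_zero_right, add_zero, ← intervalIntegral.integral_add i1 i2]
      refine intervalIntegral.integral_congr fun r hr => ?_
      rw [uIcc_of_le hst] at hr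
      simp only [hvθ r hr]
    rw [h1, hθ.norm_sq_sub hst]
    have h2 : ∫ r in s..t, c₀ * ‖θ r‖ ^ 2 ≤ ∫ r in s..t, a r (θ r) (θ r) :=
      intervalIntegral.integral_mono_on hst i3 i2 fun r hr =>
        ha.coercive r ⟨hs.trans hr.1, hr.2.trans ht⟩ _
    rw [intervalIntegral.integral_const_mul] at h2
    linarith
  have hI : 0 ≤ ∫ r in s..t, ‖θ r‖ ^ 2 :=
    intervalIntegral.integral_nonneg hst fun r _ => sq_nonneg _
  rw [hY] at hBθ
  set y := √(∫ r in s..t, ‖θ r‖ ^ 2) with hy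
  have hy2 : ∫ r in s..t, ‖θ r‖ ^ 2 = y ^ 2 := (Real.sq_sqrt hI).symm
  rw [hy2] at hlow
  have hθs : toL2 (θ s) = toL2 (proj p (toL2 g - toL2 (u s))) := by
    rw [hθdef]
    simp only [hU.apply_left hst, projH1_apply, map_sub]
  have hθt : toL2 (θ t) = toL2 (U t) - toL2 (proj p (toL2 (u t))) := by
    rw [hθdef]
    simp only [projH1_apply, map_sub]
  rw [← hθt, ← hθs]
  have hsq : B₀ * X * y - c₀ * y ^ 2 ≤ (B₀ * X) ^ 2 / (4 * c₀) := by
    rw [le_div_iff₀ (by positivity)]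
    nlinarith [sq_nonneg (B₀ * X - 2 * c₀ * y)]
  have hhalf : (B₀ * X) ^ 2 / (2 * c₀) = 2 * ((B₀ * X) ^ 2 / (4 * c₀)) := by
    field_simp; ring
  rw [hhalf]
  linarith

/-- Error of the Galerkin scheme on one interval: the constant `B₀ / (2 c₀)^{1/2}` from the energy
estimate is at most `B₀ / b`, and the projection error at time `t` is bounded by its norm in
`X(s,t)`. -/
lemma norm_sub_galerkin_le (ha : IsParabolicForm T c₀ C₀ a) {B₀ : ℝ}
    (hB : IsContinuityConst T a B₀) {f : ℝ → L2} {u₀ : L2}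
    (hu : IsSolution T a f u₀ u) (hs : 0 ≤ s) (hst : s ≤ t) (ht : t ≤ T) {p : Params} {g : H1}
    {U : ℝ → H1} (hU : IsGalerkin a f p s t g U) :
    ‖toL2 (u t) - toL2 (U t)‖ ≤ ‖toL2 (proj p (toL2 g - toL2 (u s)))‖
      + (bConst c₀ C₀ p + B₀) / bConst c₀ C₀ p
        * normX s t fun r => u r - proj p (toL2 (u r)) := by
  have hT : 0 ≤ T := hs.trans (hst.trans ht)
  have hc := ha.c₀_pos
  have hB0 := hB.nonneg hT
  have hb := bConst_pos hc (ha.le_bound hT) p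
  have hus : MemX s t u := hu.memX.mono hs ht hst
  have hη := (hus.sub (hus.clm_comp hst (projH1 p)) hst).norm_toL2_le_normX hst
  have key := norm_galerkin_sub_proj_le ha hB hu hs hst ht hU
  simp only [projH1_apply, map_sub] at hη
  set X := normX s t fun r => u r - proj p (toL2 (u r))
  set S := ‖toL2 (proj p (toL2 g - toL2 (u s)))‖
  set b := bConst c₀ C₀ p with hbdef
  have hX0 : 0 ≤ X := Real.sqrt_nonneg _
  have hb2 : b ^ 2 ≤ 2 * c₀ := by
    have h1 : b ≤ 1 / 4 := min_le_left _ _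
    have h2 : b ≤ c₀ / 4 := (min_le_right _ _).trans (min_le_left _ _)
    nlinarith
  have h1 : ‖toL2 (U t) - toL2 (proj p (toL2 (u t)))‖ ≤ S + B₀ * X / b := by
    refine le_of_sq_le_sq (key.trans ?_) (by positivity)
    have h2 : (B₀ * X) ^ 2 / (2 * c₀) ≤ (B₀ * X / b) ^ 2 := by
      rw [div_pow]
      exact div_le_div_of_nonneg_left (sq_nonneg _) (by positivity) hb2
    have h3 : 0 ≤ S * (B₀ * X / b) := mul_nonneg (norm_nonneg _) (by positivity)
    nlinarith
  have h2 : ‖toL2 (u t) - toL2 (U t)‖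
      ≤ ‖toL2 (u t) - toL2 (proj p (toL2 (u t)))‖
        + ‖toL2 (U t) - toL2 (proj p (toL2 (u t)))‖ := by
    rw [norm_sub_rev (toL2 (U t))]
    exact norm_sub_le_norm_sub_add_norm_sub _ _ _
  have h3 : (b + B₀) / b * X = X + B₀ * X / b := by field_simp
  rw [h3]
  linarith

end Form

/-! ### Accumulation of the errors -/

section Run

variable {T c₀ C₀ B₀ : ℝ} {a : ℝ → H1 →ₗ[ℝ] H1 →ₗ[ℝ] ℝ} {f : ℝ → L2} {u₀ : L2} {u : ℝ → H1}
  {K : ℕ} {τ : ℕ → ℝ} {p : ℕ → Params} {σ : ℕ → Step} {U : ℕ → ℝ → H1}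

lemma IsRun.nonneg (h : IsRun T a f u K τ p σ U) {i : ℕ} (hi : i ≤ K + 1) : 0 ≤ τ i := by
  induction i with
  | zero => exact h.start.ge
  | succ n ih => exact (ih (by omega)).trans (h.mono n (by omega))

lemma IsRun.le_T (h : IsRun T a f u K τ p σ U) {i : ℕ} (hi : i ≤ K + 1) : τ i ≤ T := by
  induction hi using Nat.decreasingInduction with
  | self => exact h.finish.le
  | of_succ n hn ih => exact (h.mono n (by omega)).trans ih

lemma IsRun.mem_P (h : IsRun T a f u K τ p σ U) {i : ℕ} (hi : i ≤ K) :
    U i (τ (i + 1)) ∈ P (p i) := by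
  cases i with
  | zero => exact h.galerkin_zero.mem _ ⟨h.mono 0 hi, le_rfl⟩
  | succ n => exact (h.galerkin_succ n (by omega)).mem _ ⟨h.mono (n + 1) hi, le_rfl⟩

/-- One adaptive step.  On an interval of positive length the `L²`-stability of the projection
absorbs the change of the Hermite space; on an interval of length zero the solution is only
projected, and the projection error of the step enters. -/
lemma IsRun.norm_sub_succ_le (h : IsRun T a f u K τ p σ U) (ha : IsParabolicForm T c₀ C₀ a)
    (hB : IsContinuityConst T a B₀) (hu : IsSolution T a f u₀ u) {i : ℕ} (hi : i < K) :
    ‖toL2 (u (τ (i + 2))) - toL2 (U (i + 1) (τ (i + 2)))‖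
      ≤ ‖toL2 (u (τ (i + 1))) - toL2 (U i (τ (i + 1)))‖
        + (bConst c₀ C₀ (p (i + 1)) + B₀) / bConst c₀ C₀ (p (i + 1)) * projErr u τ p (i + 1)
        + ((σ i).eS (p i) (U i (τ (i + 1))) + (σ i).eM (p i) (U i (τ (i + 1)))
          + (σ i).eC (p i) (U i (τ (i + 1)))) := by
  have hG := h.galerkin_succ i hi
  have hle : τ (i + 1) ≤ τ (i + 2) := h.mono (i + 1) hi
  have hidem : ∀ g : L2, proj (p (i + 1)) (toL2 (proj (p (i + 1)) g)) = proj (p (i + 1)) g :=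
    fun g => projH1_of_mem (proj_mem _ g)
  by_cases hτ : τ (i + 1) = τ (i + 2)
  · have h1 := hG.apply_left hle
    rw [hidem] at h1
    have h2 := norm_sub_proj_step_le (h.mem_P hi.le) (σ i)
    rw [← h.params i hi] at h2
    rw [projErr, if_pos ⟨by omega, hτ⟩, mul_zero, add_zero, ← hτ, h1]
    exact (norm_sub_le_norm_sub_add_norm_sub _ (toL2 (U i (τ (i + 1)))) _).trans (by gcongr)
  · have h1 := norm_sub_galerkin_le ha hB hu (h.nonneg (by omega)) hle (h.le_T (by omega)) hG
    have h2 : ‖toL2 (proj (p (i + 1)) (toL2 (proj (p (i + 1)) (toL2 (U i (τ (i + 1)))))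
        - toL2 (u (τ (i + 1)))))‖ ≤ ‖toL2 (u (τ (i + 1))) - toL2 (U i (τ (i + 1)))‖ := by
      rw [map_sub, hidem, ← map_sub, norm_sub_rev (toL2 (u _))]
      exact norm_toL2_proj_le _ _
    rw [projErr, if_neg (by tauto)]
    linarith [(σ i).eS_nonneg (p i) (U i (τ (i + 1))), (σ i).eM_nonneg (p i) (U i (τ (i + 1))),
      (σ i).eC_nonneg (p i) (U i (τ (i + 1)))]

lemma IsRun.norm_sub_le (h : IsRun T a f u K τ p σ U) (ha : IsParabolicForm T c₀ C₀ a)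
    (hB : IsContinuityConst T a B₀) (hu : IsSolution T a f u₀ u) {i : ℕ} (hi : i ≤ K) :
    ‖toL2 (u (τ (i + 1))) - toL2 (U i (τ (i + 1)))‖
      ≤ e₀ c₀ C₀ B₀ u i τ p
        + ∑ j ∈ Finset.range i, ((σ j).eS (p j) (U j (τ (j + 1)))
          + (σ j).eM (p j) (U j (τ (j + 1))) + (σ j).eC (p j) (U j (τ (j + 1)))) := by
  induction i with
  | zero =>
    have h1 := norm_sub_galerkin_le ha hB hu h.start.ge (h.mono 0 hi) (h.le_T (by omega))
      h.galerkin_zero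
    rw [show u 0 = u (τ 0) by rw [h.start], sub_self, map_zero, map_zero, norm_zero, zero_add] at h1
    simpa [e₀, projErr] using h1
  | succ n ih =>
    have h1 := h.norm_sub_succ_le ha hB hu hi
    have h2 := ih (by omega)
    rw [e₀, Finset.sum_range_succ, ← e₀, Finset.sum_range_succ]
    linarith

end Run

end AdaptiveHermite

end

theorem theorem1 (T c₀ C₀ : ℝ) (hT : 0 < T) (a : ℝ → H1 →ₗ[ℝ] H1 →ₗ[ℝ] ℝ)
    (ha : IsParabolicForm T c₀ C₀ a) :
    (∃ B₀ : ℝ, IsContinuityConst T a B₀) ∧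
    ∀ B₀ : ℝ, IsContinuityConst T a B₀ →
    ∀ (f : ℝ → L2) (u₀ : L2) (u : ℝ → H1),
      MemLp f 2 (volume.restrict (Icc 0 T)) → IsSolution T a f u₀ u →
    ∀ (K : ℕ) (τ : ℕ → ℝ) (p : ℕ → Params) (σ : ℕ → Step) (U : ℕ → ℝ → H1),
      IsRun T a f u K τ p σ U →
      ‖toL2 (u T) - toL2 (U K T)‖ ≤
          e₀ c₀ C₀ B₀ u K τ p
          + ∑ i ∈ Finset.range K, (σ i).eS (p i) (U i (τ (i + 1)))
          + ∑ i ∈ Finset.range K, (σ i).eM (p i) (U i (τ (i + 1)))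
          + ∑ i ∈ Finset.range K, (σ i).eC (p i) (U i (τ (i + 1))) ∧
      ∑ i ∈ Finset.range K, (σ i).eS (p i) (U i (τ (i + 1))) ≤
          ∑ i ∈ Finset.range K, (σ i).eS' (p i) (U i (τ (i + 1))) ∧
      ∑ i ∈ Finset.range K, (σ i).eM (p i) (U i (τ (i + 1))) ≤
          ∑ i ∈ Finset.range K, (σ i).eM' (p i) (U i (τ (i + 1))) := by
  refine ⟨⟨_, ha.isContinuityConst⟩, ?_⟩
  intro B₀ hB f u₀ u _ hu K τ p σ U hrun
  refine ⟨?_, Finset.sum_le_sum fun i hi => ?_, Finset.sum_le_sum fun i hi => ?_⟩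
  · have h := hrun.norm_sub_le ha hB hu le_rfl
    rw [hrun.finish, Finset.sum_add_distrib, Finset.sum_add_distrib] at h
    linarith
  · exact (σ i).eS_le_eS' (hrun.mem_P (Finset.mem_range.1 hi).le)
  · exact (σ i).eM_le_eM' (hrun.mem_P (Finset.mem_range.1 hi).le)
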